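/- **Theorem 5.** Let $n,m\ge 1$ and $d\ge 0$. Let $A\in M_n(\mathbb C)$ be a matrix whose eigenvalues $\lambda_1,\dots,\lambda_n$, counted with multiplicity, are non-resonant: $\sum_{i=1}^n q_i\lambda_i-\lambda_j\neq 0$ for all $j$ and all $(q_1,\dots,q_n)\in\mathbb N^n$ with $q_1+\dots+q_n\ge 2$. For each multi-index $i=(i_1,\dots,i_m)\in\mathbb N^m$ with $|i|=i_1+\dots+i_m\le d$ let $f_i:(\mathbb C^n,0)\to(\mathbb C^n,0)$ be a germ of holomorphic map with $f_i(z)=O(\|z\|^2)$. For $t\in\mathbb C^m$ consider the germ at $0$ of the holomorphic vector field $$X_t(z)=Az+\sum_{|i|\le d}t^i f_i(z).$$ Call $X_t$ holomorphically linearizable if there is a germ of biholomorphic map $h:(\mathbb C^n,0)\to(\mathbb C^n,0)$ with $Dh(z)\,X_t(z)=A\,h(z)$ near $0$. Then exactly one of the following holds: 1. $X_t$ is holomorphically linearizable for every $t\in\mathbb C^m$; 2. except for a set of values of $t\in\mathbb C^m$ of $\Gamma$-capacity $0$, $X_t$ is not holomorphically linearizable. Here the capacity $\operatorname{cap}(E)$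 of $E\subset\mathbb C$ is the logarithmic capacity, that is, the supremum of $\exp\iint\log|z-w|\,d\mu(z)\,d\mu(w)$ over the Borel probability measures $\mu$ carried by compact subsets of $E$. For $E\subset\mathbb C^{k+1}$ let $\Gamma^{k}_{k+1}(E)$ be the set of $z\in\mathbb C^{k}$ such that $\{w\in\mathbb C:(z,w)\in E\}$ has positive capacity, and for $E\subset\mathbb C^m$ put $\Gamma^1_m(E)=\Gamma^1_2\circ\cdots\circ\Gamma^{m-1}_m(E)\subset\mathbb C$ (with $\Gamma^1_1(E)=E$). The $\Gamma$-capacity of $E\subset\mathbb C^m$ is $\sup_U\operatorname{cap}\Gamma^1_m(U(E))$, where $U$ runs over the unitary transformations of $\mathbb C^m$. -/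

import Mathlib

open scoped Topology ENNReal
open MeasureTheory

noncomputable section

namespace SmallDivisors

/-! ### Logarithmic capacity in the plane -/

/-- The logarithmic energy `I(μ) = ∬ log |z - w| dμ(z) dμ(w)` of a measure on `ℂ`, with
`log 0 = -∞`, as the difference of the integrals of the positive and of the negative part.
(For a compactly supported finite measure the first integral is finite, so that the value is
`-∞` exactly when the second one diverges.) -/
def logEnergy (μ : Measure ℂ) : EReal :=
  ((∫⁻ z, ∫⁻ w, (ENNReal.log ‖z - w‖ₑ).toENNReal ∂μ ∂μ : ℝ≥0∞) : EReal)
    - ((∫⁻ z, ∫⁻ w, (-ENNReal.log ‖z - w‖ₑ).toENNReal ∂μ ∂μ : ℝ≥0∞) : EReal)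

/-- The logarithmic capacity of a set `E ⊆ ℂ`: the supremum of `exp I(μ)` over all Borel
probability measures carried by a compact subset of `E`. -/
def logCapacity (E : Set ℂ) : ℝ≥0∞ :=
  ⨆ (μ : Measure ℂ) (_ : IsProbabilityMeasure μ) (K : Set ℂ) (_ : IsCompact K)
    (_ : K ⊆ E) (_ : μ Kᶜ = 0), (logEnergy μ).exp

/-! ### Γ-capacity in `ℂ^m` -/

/-- The Γ-projection of `E ⊆ ℂ^(k+1)` to `ℂ^k`: the points `z` over which the slice
`{w | (z, w) ∈ E}` has positive capacity. -/
def gammaProj {k : ℕ} (E : Set (Fin (k + 1) → ℂ)) : Set (Fin k → ℂ) :=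
  {z | 0 < logCapacity {w | (Fin.snoc z w : Fin (k + 1) → ℂ) ∈ E}}

/-- The iterated Γ-projection of `E ⊆ ℂ^m` to the line of the first coordinate, for `m ≥ 1`
(the value for `m = 0` is a dummy). -/
def gammaProjLine : (m : ℕ) → Set (Fin m → ℂ) → Set ℂ
  | 0, _ => ∅
  | 1, E => {w | (fun _ => w) ∈ E}
  | k + 2, E => gammaProjLine (k + 1) (gammaProj E)

/-- The Γ-capacity of `E ⊆ ℂ^m`, `m ≥ 1`: the supremum, over all unitary transformations `U` of
`ℂ^m`, of the capacity of the iterated Γ-projection of `U(E)` to `ℂ`. -/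
def gammaCapacity {m : ℕ} (E : Set (Fin m → ℂ)) : ℝ≥0∞ :=
  ⨆ U : Matrix.unitaryGroup (Fin m) ℂ,
    logCapacity (gammaProjLine m ((fun t => (U : Matrix (Fin m) (Fin m) ℂ).mulVec t) '' E))

/-! ### Families of germs of holomorphic vector fields -/

/-- Multi-indices `i ∈ ℕ^m` with `|i| ≤ d`. -/
def multiIndices (m d : ℕ) : Finset (Fin m → ℕ) :=
  {i ∈ Fintype.piFinset fun _ : Fin m => Finset.range (d + 1) | ∑ j, i j ≤ d}

theorem mem_multiIndices {m d : ℕ} {i : Fin m → ℕ} :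
    i ∈ multiIndices m d ↔ ∑ j, i j ≤ d := by
  simp only [multiIndices, Finset.mem_filter, Fintype.mem_piFinset, Finset.mem_range,
    and_iff_right_iff_imp]
  intro h j
  have := Finset.single_le_sum (f := i) (fun _ _ => Nat.zero_le _) (Finset.mem_univ j)
  omega

/-- The vector field `X_t(z) = A z + ∑_{|i| ≤ d} t^i f_i(z)` on `ℂ^n`, for `t ∈ ℂ^m`. -/
def polyFamily {n m : ℕ} (d : ℕ) (A : Matrix (Fin n) (Fin n) ℂ)
    (f : (Fin m → ℕ) → (Fin n → ℂ) → (Fin n → ℂ)) (t : Fin m → ℂ) (z : Fin n → ℂ) :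
    Fin n → ℂ :=
  A.mulVec z + ∑ i ∈ multiIndices m d, (∏ j, t j ^ i j) • f i z

/-- The numbers `l_1, …, l_n` are non-resonant (in the sense of vector fields): no `l_j` equals
`q_1 l_1 + ⋯ + q_n l_n` with `q ∈ ℕ^n`, `|q| ≥ 2`. -/
def NonResonant {n : ℕ} (l : Fin n → ℂ) : Prop :=
  ∀ q : Fin n → ℕ, 2 ≤ ∑ i, q i → ∀ j, ∑ i, (q i : ℂ) * l i - l j ≠ 0

/-- The germ at `0` of the vector field `X` (with `X 0 = 0`) is holomorphically linearizable:
some germ `h : (ℂ^n, 0) → (ℂ^n, 0)` of biholomorphic map transforms `X` into its linear part,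
that is, `Dh(z) X(z) = DX(0) h(z)` near `0`. -/
def IsLinearizable {n : ℕ} (X : (Fin n → ℂ) → (Fin n → ℂ)) : Prop :=
  ∃ h : (Fin n → ℂ) → (Fin n → ℂ), AnalyticAt ℂ h 0 ∧ h 0 = 0 ∧
    (fderiv ℂ h 0).IsInvertible ∧
    ∀ᶠ z in 𝓝 0, fderiv ℂ h z (X z) = fderiv ℂ X 0 (h z)

end SmallDivisors

end

/-!
Write `X_t` for the vector field with parameter `t`. Since `A` is non-resonant, `X_t` has exactly
one formal linearization tangent to the identity, and its homogeneous part `H_k(t)` of degree `k`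
is obtained recursively by solving the homological equation `DH(z) A z - A H(z) = G(z)`. As the
solution operator does not depend on `t`, the part `H_k(t)` is polynomial in `t`, of degree at most
`d k` (`formalLinearization_mem_polyMaps`). A convergent linearization has to agree with the formal
one up to a linear factor, so that `X_t` is linearizable if and only if the norms of the symmetric
multilinear maps of the `H_k(t)` are bounded by `K ^ k` for some `K` (`isLinearizable_iff`). Hence
the set of linearizable parameters is the set of points at which a family of polynomials, with
degrees dominated by weights, is exponentially bounded with respect to these weights
(`exists_isLinearizable_iff_mem_expBounded`).

For such a family in one variable, a Bernstein–Walsh argument shows that exponential boundedness on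
a set of positive capacity implies uniform exponential boundedness on every disc: one of the
closed sets `{w | ∀ i, |p_i(w)| ≤ k ^ ν_i}` carries a measure `μ` with bounded logarithmic
potential, some point of its support is on average not too close to the roots of a given
polynomial, and at this point each linear factor is comparable with its value anywhere in the disc
(`exists_norm_eval_le_of_potential`). In several variables the iterated Γ-projection is
handled one variable at a time (`mem_expBounded_of_gammaProjLine`): the Γ-projection of the locus
of exponential boundedness is contained in the locus for the family in which the last variable
takes all values in the unit disc. So this locus has Γ-capacity `0` unless it is everything, and
the two cases exclude each other since the disc has positive capacity.

The eigenvalue count for the homological equation is done on multilinear maps: a multilinear map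
that intertwines the action of `A` on tuples with `A` kills all tuples of generalized eigenvectors
(`apply_eq_zero_of_genEigenvectors`), without any need to triangularize `A`.
-/

namespace SmallDivisors

/-! ### Logarithmic potentials and growth of polynomials -/

/-- The negative part `log⁻ |z - w|` of the logarithmic kernel, with value `∞` on the diagonal. -/
noncomputable def logNeg (z w : ℂ) : ℝ≥0∞ := (-ENNReal.log ‖z - w‖ₑ).toENNReal

theorem logNeg_self (z : ℂ) : logNeg z z = ∞ := by simp [logNeg]

theorem logNeg_of_ne {z w : ℂ} (h : z ≠ w) :
    logNeg z w = ENNReal.ofReal (-Real.log ‖z - w‖) := by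
  have hpos : 0 < ‖z - w‖ := norm_pos_iff.2 (sub_ne_zero.2 h)
  rw [logNeg, ← ofReal_norm, ENNReal.log_ofReal_of_pos hpos, ← EReal.coe_neg,
    EReal.toENNReal_of_ne_top (EReal.coe_ne_top _), EReal.toReal_coe]

theorem measurable_logNeg : Measurable fun p : ℂ × ℂ => logNeg p.1 p.2 := by
  unfold logNeg
  have h1 : Measurable fun p : ℂ × ℂ => ‖p.1 - p.2‖ₑ := by fun_prop
  have h2 : Measurable fun p : ℂ × ℂ => -ENNReal.log ‖p.1 - p.2‖ₑ :=
    (ENNReal.measurable_log.comp h1).neg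
  exact h2.ereal_toENNReal

theorem measurable_logNeg_right (z : ℂ) : Measurable (logNeg z) :=
  Measurable.of_uncurry_left (f := logNeg) measurable_logNeg

theorem logNeg_le_add_log_two {a z w : ℂ} (h : ‖z - w‖ ≤ 2 * ‖a - w‖) :
    logNeg a w ≤ logNeg z w + ENNReal.ofReal (Real.log 2) := by
  rcases eq_or_ne z w with rfl | hz
  · simp [logNeg_self]
  have hz' : 0 < ‖z - w‖ := norm_pos_iff.2 (sub_ne_zero.2 hz)
  have ha' : 0 < ‖a - w‖ := by linarith
  have ha : a ≠ w := by rintro rfl; simp at ha'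
  rw [logNeg_of_ne hz, logNeg_of_ne ha]
  refine le_trans (ENNReal.ofReal_le_ofReal ?_) ENNReal.ofReal_add_le
  have := Real.log_le_log hz' h
  rw [Real.log_mul two_ne_zero ha'.ne'] at this
  linarith

/-- A linear factor grows, from a point `ζ` of a disc to any other point `w` of it, by at most a
constant multiple of `exp (log⁻ |a - ζ|)`. -/
theorem norm_sub_le_mul_exp_logNeg {a w ζ : ℂ} {R : ℝ} (hw : ‖w‖ ≤ R) (hζ : ‖ζ‖ ≤ R)
    (h : logNeg a ζ ≠ ∞) :
    ‖w - a‖ ≤ ‖ζ - a‖ * ((2 * R + 1) * Real.exp (logNeg a ζ).toReal) := by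
  have hne : a ≠ ζ := by rintro rfl; exact h (logNeg_self _)
  have hpos : 0 < ‖ζ - a‖ := norm_pos_iff.2 (sub_ne_zero.2 hne.symm)
  rw [logNeg_of_ne hne, norm_sub_rev a ζ, ENNReal.toReal_ofReal']
  set x := ‖ζ - a‖
  have hR : 0 ≤ R := (norm_nonneg w).trans hw
  have h1 : ‖w - a‖ ≤ 2 * R + x := by
    have : w - a = (w - ζ) + (ζ - a) := by ring
    rw [this]
    have := norm_add_le (w - ζ) (ζ - a)
    have := norm_sub_le w ζ
    linarith
  set e := Real.exp (max (-Real.log x) 0)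
  have he1 : 1 ≤ e := Real.one_le_exp (le_max_right _ _)
  have he2 : 1 ≤ x * e := by
    have : x⁻¹ ≤ e := by
      rw [← Real.exp_log (inv_pos.2 hpos), Real.log_inv]
      exact Real.exp_le_exp.2 (le_max_left _ _)
    calc (1 : ℝ) = x * x⁻¹ := (mul_inv_cancel₀ hpos.ne').symm
      _ ≤ x * e := by gcongr
  nlinarith

/-- The product version of `norm_sub_le_mul_exp_logNeg`, for the factorization of a polynomial. -/
theorem norm_eval_le_mul_exp_logNeg (P : Polynomial ℂ) {w ζ : ℂ} {R : ℝ} (hw : ‖w‖ ≤ R)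
    (hζ : ‖ζ‖ ≤ R) (h : (P.roots.map fun a => logNeg a ζ).sum ≠ ∞) :
    ‖P.eval w‖ ≤ ‖P.eval ζ‖ * ((2 * R + 1) ^ P.natDegree *
      Real.exp (P.roots.map fun a => logNeg a ζ).sum.toReal) := by
  have hR : 0 ≤ R := (norm_nonneg w).trans hw
  have key : ∀ s : Multiset ℂ, (s.map fun a => logNeg a ζ).sum ≠ ∞ →
      ‖(s.map fun a => w - a).prod‖ ≤ ‖(s.map fun a => ζ - a).prod‖ *
        ((2 * R + 1) ^ s.card * Real.exp (s.map fun a => logNeg a ζ).sum.toReal) := by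
    intro s
    induction s using Multiset.induction with
    | empty => simp
    | cons a s ih =>
      intro hs
      simp only [Multiset.map_cons, Multiset.sum_cons, Multiset.prod_cons, Multiset.card_cons,
        norm_mul] at hs ⊢
      obtain ⟨ha, hs⟩ := ENNReal.add_ne_top.1 hs
      rw [ENNReal.toReal_add ha hs, Real.exp_add]
      calc _ ≤ _ := mul_le_mul (norm_sub_le_mul_exp_logNeg hw hζ ha) (ih hs) (norm_nonneg _)
            (by positivity)
        _ = _ := by ring
  -- for `P = 0` there are no roots and both sides are `0`
  have hsplit := IsAlgClosed.splits P
  have hcard : P.roots.card = P.natDegree := hsplit.natDegree_eq_card_roots.symm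
  rw [hsplit.eval_eq_prod_roots, hsplit.eval_eq_prod_roots, norm_mul, norm_mul, mul_assoc,
    ← hcard]
  gcongr
  exact key _ h

/-- A logarithmic potential that is bounded above on the support of its measure is bounded above
everywhere: compare with the nearest point of the support. -/
theorem lintegral_logNeg_le_of_forall_mem {μ : Measure ℂ} {F : Set ℂ} (hF : IsCompact F)
    (hne : F.Nonempty) {V : ℝ≥0∞} (hV : ∀ z ∈ F, ∫⁻ w in F, logNeg z w ∂μ ≤ V) (a : ℂ) :
    ∫⁻ w in F, logNeg a w ∂μ ≤ V + ENNReal.ofReal (Real.log 2) * μ F := by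
  obtain ⟨z, hz, hmin⟩ := hF.exists_infDist_eq_dist hne a
  calc ∫⁻ w in F, logNeg a w ∂μ
      ≤ ∫⁻ w in F, (logNeg z w + ENNReal.ofReal (Real.log 2)) ∂μ := by
        refine setLIntegral_mono' hF.measurableSet fun w hw => logNeg_le_add_log_two ?_
        have h1 : dist a z ≤ dist a w := hmin ▸ Metric.infDist_le_dist_of_mem hw
        rw [← dist_eq_norm, ← dist_eq_norm]
        have := dist_triangle z a w
        rw [dist_comm z a] at this
        linarith
    _ = ∫⁻ w in F, logNeg z w ∂μ + ENNReal.ofReal (Real.log 2) * μ F := by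
        rw [lintegral_add_right _ measurable_const, setLIntegral_const]
    _ ≤ _ := by gcongr; exact hV z hz

/-- A Bernstein–Walsh inequality: on a compact set carrying a measure of bounded logarithmic
potential, a bound for a polynomial propagates to any disc, with a loss that is exponential in
the degree. By averaging, some point of the set is not too close to the roots. -/
theorem exists_norm_eval_le_of_potential {μ : Measure ℂ} [IsFiniteMeasure μ] {F : Set ℂ}
    (hF : IsCompact F) (hμ : μ F ≠ 0) {V : ℝ≥0∞} (hVtop : V ≠ ∞)
    (hV : ∀ z ∈ F, ∫⁻ w in F, logNeg z w ∂μ ≤ V) (R : ℝ) :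
    ∃ B : ℝ, 1 ≤ B ∧ ∀ (P : Polynomial ℂ) (N : ℕ) (M : ℝ), P.natDegree ≤ N →
      (∀ ζ ∈ F, ‖P.eval ζ‖ ≤ M) → ∀ w : ℂ, ‖w‖ ≤ R → ‖P.eval w‖ ≤ M * B ^ N := by
  have hne : F.Nonempty := nonempty_of_measure_ne_zero hμ
  obtain ⟨R₁, hR₁⟩ := hF.isBounded.exists_norm_le
  set R' := max (max R R₁) 0
  have hR' : 0 ≤ R' := le_max_right _ _
  set V' : ℝ≥0∞ := (V + ENNReal.ofReal (Real.log 2) * μ F) / μ F with hV'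
  have hV'top : V' ≠ ∞ := by
    refine ENNReal.div_ne_top (ENNReal.add_ne_top.2 ⟨hVtop, ?_⟩) hμ
    exact ENNReal.mul_ne_top ENNReal.ofReal_ne_top (measure_ne_top _ _)
  have hB1 : 1 ≤ 2 * R' + 1 := by linarith
  have hB : 1 ≤ (2 * R' + 1) * Real.exp V'.toReal :=
    one_le_mul_of_one_le_of_one_le hB1 (Real.one_le_exp ENNReal.toReal_nonneg)
  refine ⟨_, hB, fun P N M hP hM w hw => ?_⟩
  have hmeas : ∀ s : Multiset ℂ, Measurable fun ζ => (s.map fun a => logNeg a ζ).sum := by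
    intro s
    induction s using Multiset.induction with
    | empty => simp
    | cons a s ih =>
      simp only [Multiset.map_cons, Multiset.sum_cons]
      exact (measurable_logNeg_right a).add ih
  have hint : ∀ s : Multiset ℂ, ∫⁻ ζ in F, (s.map fun a => logNeg a ζ).sum ∂μ
      ≤ s.card * (V + ENNReal.ofReal (Real.log 2) * μ F) := by
    intro s
    induction s using Multiset.induction with
    | empty => simp
    | cons a s ih =>
      simp only [Multiset.map_cons, Multiset.sum_cons, Multiset.card_cons, Nat.cast_add,
        Nat.cast_one, add_mul, one_mul]
      rw [lintegral_add_left (measurable_logNeg_right a), add_comm]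
      exact add_le_add ih (lintegral_logNeg_le_of_forall_mem hF hne hV a)
  -- `ζ` is a point of `F` at which the sum over the roots is at most its mean
  obtain ⟨ζ, hζF, hζ⟩ := exists_le_setLAverage hμ (measure_ne_top _ _)
    (hmeas P.roots).aemeasurable
  have hle : (P.roots.map fun a => logNeg a ζ).sum ≤ P.roots.card * V' := by
    refine hζ.trans ?_
    rw [setLAverage_eq, hV', ← mul_div_assoc]
    exact ENNReal.div_le_div_right (hint _) _
  have htop : (P.roots.card : ℝ≥0∞) * V' ≠ ∞ := ENNReal.mul_ne_top (by simp) hV'top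
  have hcard : P.roots.card ≤ N := (P.card_roots').trans hP
  have hreal : (P.roots.map fun a => logNeg a ζ).sum.toReal ≤ N * V'.toReal := by
    have := ENNReal.toReal_mono htop hle
    rw [ENNReal.toReal_mul, ENNReal.toReal_natCast] at this
    refine this.trans ?_
    gcongr
  have hM0 : 0 ≤ M := (norm_nonneg _).trans (hM ζ hζF)
  calc ‖P.eval w‖ ≤ ‖P.eval ζ‖ * ((2 * R' + 1) ^ P.natDegree *
        Real.exp (P.roots.map fun a => logNeg a ζ).sum.toReal) :=
        norm_eval_le_mul_exp_logNeg P
          (hw.trans ((le_max_left _ _).trans (le_max_left _ _)))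
          ((hR₁ ζ hζF).trans ((le_max_right _ _).trans (le_max_left _ _)))
          (ne_top_of_le_ne_top htop hle)
    _ ≤ M * ((2 * R' + 1) ^ N * Real.exp (N * V'.toReal)) := by
        gcongr
        exact hM ζ hζF
    _ = M * ((2 * R' + 1) * Real.exp V'.toReal) ^ N := by
        rw [mul_pow, ← Real.exp_nat_mul]

/-! ### Sets of positive logarithmic capacity -/

theorem logCapacity_mono {E E' : Set ℂ} (h : E ⊆ E') : logCapacity E ≤ logCapacity E' :=
  iSup_mono fun _ => iSup_mono fun _ => iSup_mono fun _ => iSup_mono fun _ =>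
    iSup_le fun hK => le_iSup_of_le (hK.trans h) le_rfl

theorem logEnergy_ne_bot_iff {μ : Measure ℂ} :
    logEnergy μ ≠ ⊥ ↔ ∫⁻ z, ∫⁻ w, logNeg z w ∂μ ∂μ ≠ ∞ := by
  unfold logEnergy
  change _ ↔ ∫⁻ z, ∫⁻ w, (-ENNReal.log ‖z - w‖ₑ).toENNReal ∂μ ∂μ ≠ ∞
  generalize (∫⁻ z, ∫⁻ w, (ENNReal.log ‖z - w‖ₑ).toENNReal ∂μ ∂μ) = a
  generalize (∫⁻ z, ∫⁻ w, (-ENNReal.log ‖z - w‖ₑ).toENNReal ∂μ ∂μ) = b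
  rw [sub_eq_add_neg, ne_eq, EReal.add_eq_bot_iff]
  simp [EReal.neg_eq_bot_iff]

theorem exists_measure_of_logCapacity_pos {E : Set ℂ} (h : 0 < logCapacity E) :
    ∃ (μ : Measure ℂ) (_ : IsProbabilityMeasure μ) (K : Set ℂ), IsCompact K ∧ K ⊆ E ∧
      μ Kᶜ = 0 ∧ ∫⁻ z, ∫⁻ w, logNeg z w ∂μ ∂μ ≠ ∞ := by
  simp only [logCapacity, lt_iSup_iff] at h
  obtain ⟨μ, hμ, K, hK, hKE, h0, h⟩ := h
  refine ⟨μ, hμ, K, hK, hKE, h0, logEnergy_ne_bot_iff.1 fun hb => ?_⟩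
  simp [hb] at h

theorem logCapacity_pos {E K : Set ℂ} (μ : Measure ℂ) [IsProbabilityMeasure μ] (hK : IsCompact K)
    (hKE : K ⊆ E) (h0 : μ Kᶜ = 0) (h : ∫⁻ z, ∫⁻ w, logNeg z w ∂μ ∂μ ≠ ∞) :
    0 < logCapacity E := by
  simp only [logCapacity, lt_iSup_iff]
  refine ⟨μ, inferInstance, K, hK, hKE, h0, ?_⟩
  have := logEnergy_ne_bot_iff.2 h
  rw [pos_iff_ne_zero]
  simpa using this

/-- If a set of positive capacity is covered by countably many closed sets, then one of these
contains a compact set that carries a measure with bounded potential. -/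
theorem exists_isCompact_potential_of_logCapacity_pos {E : Set ℂ} (h : 0 < logCapacity E)
    {S : ℕ → Set ℂ} (hS : ∀ k, IsClosed (S k)) (hE : E ⊆ ⋃ k, S k) :
    ∃ (μ : Measure ℂ) (_ : IsFiniteMeasure μ) (k : ℕ) (F : Set ℂ) (V : ℝ≥0∞), IsCompact F ∧
      F ⊆ S k ∧ μ F ≠ 0 ∧ V ≠ ∞ ∧ ∀ z ∈ F, ∫⁻ w in F, logNeg z w ∂μ ≤ V := by
  obtain ⟨μ, hμ, K, hK, hKE, h0, hfin⟩ := exists_measure_of_logCapacity_pos h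
  have hg : Measurable fun z => ∫⁻ w, logNeg z w ∂μ :=
    measurable_logNeg.lintegral_prod_right'
  have hae := ae_lt_top hg hfin
  -- cover by countably many sets on which both the index and the potential of `μ` are bounded
  have hcov : μ (⋃ p : ℕ × ℕ, S p.1 ∩ {z | ∫⁻ w, logNeg z w ∂μ ≤ p.2}) ≠ 0 := by
    intro hz
    have hKae : ∀ᵐ z ∂μ, z ∈ K := by rwa [ae_iff]
    have hfalse : ∀ᵐ z ∂μ, False := by
      filter_upwards [hae, hKae, measure_eq_zero_iff_ae_notMem.1 hz] with z hz1 hz2 hz3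
      obtain ⟨k, hk⟩ := Set.mem_iUnion.1 (hE (hKE hz2))
      obtain ⟨V, hV⟩ := ENNReal.exists_nat_gt hz1.ne
      exact hz3 (Set.mem_iUnion.2 ⟨(k, V), hk, hV.le⟩)
    simp at hfalse
    exact IsProbabilityMeasure.ne_zero μ hfalse
  obtain ⟨⟨k, V⟩, hkV⟩ : ∃ p : ℕ × ℕ, μ (S p.1 ∩ {z | ∫⁻ w, logNeg z w ∂μ ≤ p.2}) ≠ 0 := by
    by_contra! hall
    exact hcov (measure_iUnion_null hall)
  have hmeas : MeasurableSet (S k ∩ {z | ∫⁻ w, logNeg z w ∂μ ≤ V}) :=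
    (hS k).measurableSet.inter (measurableSet_le hg measurable_const)
  obtain ⟨F, hFS, hF, hF0⟩ := hmeas.exists_lt_isCompact (pos_iff_ne_zero.2 hkV)
  refine ⟨μ, inferInstance, k, F, V, hF, fun z hz => (hFS hz).1, hF0.ne', by simp, ?_⟩
  intro z hz
  exact (setLIntegral_le_lintegral _ _).trans (hFS hz).2

/-- A family of polynomials whose degrees are dominated by the weights `ν`, and that is
exponentially bounded, in terms of `ν`, at each point of a set of positive capacity, is
exponentially bounded uniformly on every disc. -/
theorem exists_norm_eval_le_pow_of_logCapacity_pos {I : Type*} (P : I → Polynomial ℂ) (ν : I → ℕ)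
    (C : ℕ) (hP : ∀ i, (P i).natDegree ≤ C * ν i)
    (h : 0 < logCapacity {w | ∃ k : ℕ, ∀ i, ‖(P i).eval w‖ ≤ (k : ℝ) ^ ν i}) (R : ℝ) :
    ∃ K : ℕ, ∀ w : ℂ, ‖w‖ ≤ R → ∀ i, ‖(P i).eval w‖ ≤ (K : ℝ) ^ ν i := by
  set S : ℕ → Set ℂ := fun k => {w | ∀ i, ‖(P i).eval w‖ ≤ (k : ℝ) ^ ν i} with hSdef
  have hS : ∀ k, IsClosed (S k) := by
    intro k
    simp only [hSdef, Set.ofPred_forall]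
    exact isClosed_iInter fun i => isClosed_le (by fun_prop) continuous_const
  obtain ⟨μ, hμ, k, F, V, hF, hFS, hF0, hV, hpot⟩ :=
    exists_isCompact_potential_of_logCapacity_pos h hS
      (fun w ⟨k, hk⟩ => Set.mem_iUnion.2 ⟨k, hk⟩)
  obtain ⟨B, hB1, hB⟩ := exists_norm_eval_le_of_potential hF hF0 hV hpot R
  obtain ⟨K, hK⟩ := exists_nat_ge (k * B ^ C : ℝ)
  refine ⟨K, fun w hw i => ?_⟩
  calc ‖(P i).eval w‖ ≤ (k : ℝ) ^ ν i * B ^ (C * ν i) :=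
        hB _ _ _ (hP i) (fun ζ hζ => hFS hζ i) w hw
    _ = (k * B ^ C) ^ ν i := by rw [mul_pow, pow_mul]
    _ ≤ (K : ℝ) ^ ν i := by
        have : 0 ≤ B := by linarith
        gcongr

/-- The unit disc has positive capacity, since Lebesgue measure on `[0, 1]` has finite energy. -/
theorem logCapacity_closedBall_pos : 0 < logCapacity (Metric.closedBall (0 : ℂ) 1) := by
  have hm : Measurable ((↑) : ℝ → ℂ) := Complex.measurable_ofReal
  set ρ : Measure ℝ := volume.restrict (Set.Icc 0 1)
  have : IsProbabilityMeasure ρ := ⟨by simp [ρ]⟩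
  have : IsProbabilityMeasure (ρ.map ((↑) : ℝ → ℂ)) :=
    Measure.isProbabilityMeasure_map hm.aemeasurable
  have hK : IsCompact (((↑) : ℝ → ℂ) '' Set.Icc 0 1) :=
    isCompact_Icc.image Complex.continuous_ofReal
  refine logCapacity_pos (ρ.map ((↑) : ℝ → ℂ)) hK ?_ ?_ ?_
  · rintro _ ⟨x, hx, rfl⟩
    simpa [abs_le] using ⟨by linarith [hx.1], hx.2⟩
  · rw [Measure.map_apply hm hK.measurableSet.compl, Measure.restrict_apply
      (hm hK.measurableSet.compl)]
    convert measure_empty (μ := (volume : Measure ℝ))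
    ext x
    simp only [Set.mem_inter_iff, Set.mem_preimage, Set.mem_compl_iff, Set.mem_empty_iff_false,
      iff_false, not_and]
    intro h1 h2
    exact h1 ⟨x, h2, rfl⟩
  set J : ℝ≥0∞ := ∫⁻ u in Set.Icc (-1 : ℝ) 1, ENNReal.ofReal (-Real.log u)
  have hJ : J ≠ ∞ := by
    have hint : IntegrableOn (fun u : ℝ => -Real.log u) (Set.Icc (-1) 1) := by
      have := (intervalIntegral.intervalIntegrable_log' (a := -1) (b := 1)).neg
      rwa [intervalIntegrable_iff_integrableOn_Icc_of_le (by norm_num)] at this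
    have := hint.lintegral_lt_top
    exact this.ne
  have hin : ∀ x ∈ Set.Icc (0 : ℝ) 1, ∫⁻ w, logNeg (x : ℂ) w ∂(ρ.map ((↑) : ℝ → ℂ)) ≤ J := by
    intro x hx
    rw [lintegral_map (measurable_logNeg_right _) hm]
    have hshift : J = ∫⁻ y in Set.Icc (x - 1) (x + 1), ENNReal.ofReal (-Real.log (x - y)) := by
      have hmp : MeasurePreserving (fun y : ℝ => x - y) volume volume :=
        Measure.measurePreserving_sub_left volume x
      have hpre : (fun y : ℝ => x - y) ⁻¹' Set.Icc (-1) 1 = Set.Icc (x - 1) (x + 1) := by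
        ext y
        simp only [Set.mem_preimage, Set.mem_Icc]
        constructor <;> rintro ⟨h1, h2⟩ <;> constructor <;> linarith
      rw [← hpre, hmp.setLIntegral_comp_preimage measurableSet_Icc (f := fun u =>
        ENNReal.ofReal (-Real.log u)) (by fun_prop)]
    rw [hshift]
    calc ∫⁻ y : ℝ in Set.Icc 0 1, logNeg (x : ℂ) y
        ≤ ∫⁻ y : ℝ in Set.Icc 0 1, ENNReal.ofReal (-Real.log (x - y)) := by
          refine lintegral_mono_ae ?_
          have hne : ∀ᵐ y ∂(volume : Measure ℝ), y ≠ x := by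
            simp [ae_iff]
          filter_upwards [ae_restrict_of_ae hne] with y hy
          rw [logNeg_of_ne (by exact_mod_cast hy.symm), ← Complex.ofReal_sub, Complex.norm_real,
            Real.norm_eq_abs, Real.log_abs]
      _ ≤ _ := lintegral_mono_set (Set.Icc_subset_Icc (by linarith [hx.2]) (by linarith [hx.1]))
  have hg : Measurable fun z => ∫⁻ w, logNeg z w ∂(ρ.map ((↑) : ℝ → ℂ)) :=
    measurable_logNeg.lintegral_prod_right'
  rw [lintegral_map hg hm]
  refine ne_top_of_le_ne_top hJ ?_
  calc ∫⁻ x : ℝ in Set.Icc 0 1, ∫⁻ w, logNeg (x : ℂ) w ∂(ρ.map ((↑) : ℝ → ℂ))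
      ≤ ∫⁻ _ in Set.Icc (0 : ℝ) 1, J := setLIntegral_mono' measurableSet_Icc hin
    _ = J := by simp

/-! ### Γ-capacity and exponentially bounded families of polynomials -/

theorem gammaProj_mono {k : ℕ} {E E' : Set (Fin (k + 1) → ℂ)} (h : E ⊆ E') :
    gammaProj E ⊆ gammaProj E' :=
  fun _ hz => lt_of_lt_of_le hz (logCapacity_mono fun _ hw => h hw)

theorem gammaProjLine_mono : ∀ (m : ℕ) {E E' : Set (Fin m → ℂ)}, E ⊆ E' →
    gammaProjLine m E ⊆ gammaProjLine m E'
  | 0, _, _, _ => subset_rfl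
  | 1, _, _, h => fun _ hw => h hw
  | k + 2, _, _, h => gammaProjLine_mono (k + 1) (gammaProj_mono h)

theorem logCapacity_univ_pos : 0 < logCapacity Set.univ :=
  logCapacity_closedBall_pos.trans_le (logCapacity_mono (Set.subset_univ _))

theorem gammaProjLine_univ : ∀ m : ℕ, gammaProjLine (m + 1) Set.univ = Set.univ
  | 0 => rfl
  | k + 1 => by
    have h : gammaProj (Set.univ : Set (Fin (k + 2) → ℂ)) = Set.univ := by
      ext z
      simpa [gammaProj] using logCapacity_univ_pos
    rw [gammaProjLine, h, gammaProjLine_univ k]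

theorem gammaCapacity_univ_ne_zero (m : ℕ) :
    gammaCapacity (Set.univ : Set (Fin (m + 1) → ℂ)) ≠ 0 := by
  refine (lt_of_lt_of_le ?_ (le_iSup _ (1 : Matrix.unitaryGroup (Fin (m + 1)) ℂ))).ne'
  simpa [gammaProjLine_univ] using logCapacity_univ_pos

/-- The functions on `ℂ^m` whose restriction to each complex line `w ↦ a + w b` is a polynomial
of degree at most `N`. This class contains the polynomials of total degree at most `N`, and is
visibly stable under linear substitutions and under fixing some of the variables. -/
def lineDegree (m N : ℕ) : Submodule ℂ ((Fin m → ℂ) → ℂ) where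
  carrier := {g | ∀ a b : Fin m → ℂ, ∃ P : Polynomial ℂ, P.natDegree ≤ N ∧
    ∀ w : ℂ, g (a + w • b) = P.eval w}
  add_mem' {g g'} hg hg' a b := by
    obtain ⟨P, hP, h⟩ := hg a b
    obtain ⟨P', hP', h'⟩ := hg' a b
    exact ⟨P + P', Polynomial.natDegree_add_le_of_degree_le hP hP', fun w => by simp [h, h']⟩
  zero_mem' a b := ⟨0, by simp, by simp⟩
  smul_mem' c g hg a b := by
    obtain ⟨P, hP, h⟩ := hg a b
    exact ⟨c • P, (Polynomial.natDegree_smul_le c P).trans hP, fun w => by simp [h]⟩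

theorem lineDegree_mono (m : ℕ) : Monotone (lineDegree m) := fun _ _ hN _ hg a b =>
  let ⟨P, hP, h⟩ := hg a b
  ⟨P, hP.trans hN, h⟩

theorem one_mem_lineDegree (m N : ℕ) : (1 : (Fin m → ℂ) → ℂ) ∈ lineDegree m N :=
  fun _ _ => ⟨1, by simp, by simp⟩

theorem apply_mem_lineDegree {m : ℕ} (j : Fin m) : (fun t => t j) ∈ lineDegree m 1 := fun a b =>
  ⟨Polynomial.C (a j) + Polynomial.C (b j) * Polynomial.X, by compute_degree, fun w => by
    simp only [Pi.add_apply, Pi.smul_apply, smul_eq_mul, Polynomial.eval_add, Polynomial.eval_mul,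
      Polynomial.eval_C, Polynomial.eval_X, mul_comm]⟩

theorem mul_mem_lineDegree {m N N' : ℕ} {g g' : (Fin m → ℂ) → ℂ} (hg : g ∈ lineDegree m N)
    (hg' : g' ∈ lineDegree m N') : g * g' ∈ lineDegree m (N + N') := fun a b => by
  obtain ⟨P, hP, h⟩ := hg a b
  obtain ⟨P', hP', h'⟩ := hg' a b
  exact ⟨P * P', Polynomial.natDegree_mul_le_of_le hP hP', fun w => by simp [h, h']⟩

theorem prod_pow_mem_lineDegree {m d : ℕ} {i : Fin m → ℕ} (hi : ∑ j, i j ≤ d) :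
    (fun t : Fin m → ℂ => ∏ j, t j ^ i j) ∈ lineDegree m d := by
  have hpow : ∀ (j : Fin m) (r : ℕ), (fun t : Fin m → ℂ => t j ^ r) ∈ lineDegree m r := by
    intro j r
    induction r with
    | zero => simpa using! one_mem_lineDegree m 0
    | succ r ih => simpa only [pow_succ] using! mul_mem_lineDegree ih (apply_mem_lineDegree j)
  have hprod : ∀ s : Finset (Fin m),
      (fun t : Fin m → ℂ => ∏ j ∈ s, t j ^ i j) ∈ lineDegree m (∑ j ∈ s, i j) := by
    intro s
    induction s using Finset.induction_on with
    | empty => simpa using! one_mem_lineDegree m 0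
    | insert a s ha ih =>
      simp only [Finset.prod_insert ha, Finset.sum_insert ha]
      exact mul_mem_lineDegree (hpow a _) ih
  exact lineDegree_mono m hi (hprod Finset.univ)

/-- The set of points at which the family of functions `p` is exponentially bounded with respect
to the weights `ν`. -/
def expBounded {X I : Type*} (p : I → X → ℂ) (ν : I → ℕ) : Set X :=
  {x | ∃ k : ℕ, ∀ i, ‖p i x‖ ≤ (k : ℝ) ^ ν i}

/-- On a complex line, exponential boundedness on a set of positive capacity implies uniform
exponential boundedness on discs. -/
theorem exists_forall_norm_le_pow_on_line {m : ℕ} {I : Type*} {p : I → (Fin m → ℂ) → ℂ}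
    {ν : I → ℕ} {C : ℕ} (hp : ∀ i, p i ∈ lineDegree m (C * ν i)) (a b : Fin m → ℂ)
    (h : 0 < logCapacity {w : ℂ | a + w • b ∈ expBounded p ν}) (R : ℝ) :
    ∃ K : ℕ, ∀ w : ℂ, ‖w‖ ≤ R → ∀ i, ‖p i (a + w • b)‖ ≤ (K : ℝ) ^ ν i := by
  choose P hP hPeval using fun i => hp i a b
  simp only [expBounded, Set.mem_ofPred_eq, hPeval] at h ⊢
  exact exists_norm_eval_le_pow_of_logCapacity_pos P ν C hP h R

theorem snoc_eq_add_smul {m : ℕ} (z : Fin m → ℂ) (w : ℂ) :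
    (Fin.snoc z w : Fin (m + 1) → ℂ) =
      (Fin.snoc z 0 : Fin (m + 1) → ℂ) + w • (Fin.snoc 0 1 : Fin (m + 1) → ℂ) := by
  ext j
  refine Fin.lastCases ?_ (fun j => ?_) j <;> simp

/-- If the iterated Γ-projection of the locus of exponential boundedness of a family of
polynomials has positive capacity, then this locus is everything. Each Γ-projection is contained
in the corresponding locus of the enlarged family obtained by giving the last variable all the
values in the unit disc. -/
theorem mem_expBounded_of_gammaProjLine : ∀ (m : ℕ) {I : Type*} (p : I → (Fin (m + 1) → ℂ) → ℂ)
    (ν : I → ℕ) (C : ℕ), (∀ i, p i ∈ lineDegree (m + 1) (C * ν i)) →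
    0 < logCapacity (gammaProjLine (m + 1) (expBounded p ν)) → ∀ t, t ∈ expBounded p ν
  | 0, I, p, ν, C, hp, h, t => by
    have hline : ∀ w : ℂ, (0 + w • 1 : Fin 1 → ℂ) = fun _ => w := fun w => by ext; simp
    obtain ⟨K, hK⟩ := exists_forall_norm_le_pow_on_line hp 0 1 (by
      simpa only [hline] using! h) ‖t 0‖
    refine ⟨K, ?_⟩
    have ht : t = (0 + t 0 • 1 : Fin 1 → ℂ) := by
      ext j
      obtain rfl : j = 0 := Fin.fin_one_eq_zero j
      simp
    rw [ht]
    exact hK _ le_rfl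
  | m + 1, I, p, ν, C, hp, h, t => by
    set D := Metric.closedBall (0 : ℂ) 1
    set p' : I × D → (Fin (m + 1) → ℂ) → ℂ := fun x z => p x.1 (Fin.snoc z (x.2 : ℂ))
    have hp' : ∀ x, p' x ∈ lineDegree (m + 1) (C * ν x.1) := by
      intro x a b
      obtain ⟨P, hP, hPe⟩ := hp x.1 (Fin.snoc a (x.2 : ℂ)) (Fin.snoc b 0)
      refine ⟨P, hP, fun w => ?_⟩
      rw [← hPe]
      change p x.1 _ = p x.1 _
      congr 1
      ext j
      refine Fin.lastCases ?_ (fun j => ?_) j <;>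
        simp only [Fin.snoc_castSucc, Fin.snoc_last, Pi.add_apply, Pi.smul_apply, smul_eq_mul,
          mul_zero, add_zero]
    have hsub : gammaProj (expBounded p ν) ⊆ expBounded p' fun x => ν x.1 := by
      intro z hz
      have hz : 0 < logCapacity {w | (Fin.snoc z w : Fin (m + 2) → ℂ) ∈ expBounded p ν} := hz
      rw [funext fun w => congrArg (· ∈ expBounded p ν) (snoc_eq_add_smul z w)] at hz
      obtain ⟨K, hK⟩ := exists_forall_norm_le_pow_on_line hp _ _ hz 1
      refine ⟨K, fun x => ?_⟩
      change ‖p x.1 (Fin.snoc z (x.2 : ℂ))‖ ≤ _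
      rw [snoc_eq_add_smul]
      exact hK _ (mem_closedBall_zero_iff.1 x.2.2) _
    have hall := mem_expBounded_of_gammaProjLine m p' (fun x => ν x.1) C hp'
      (h.trans_le (logCapacity_mono (gammaProjLine_mono _ hsub)))
    obtain ⟨k, hk⟩ := hall (Fin.init t)
    have ht : t = Fin.snoc (Fin.init t) (t (Fin.last _)) := (Fin.snoc_init_self t).symm
    have hcap : Metric.closedBall (0 : ℂ) 1 ⊆ {w : ℂ | (Fin.snoc (Fin.init t) 0 : Fin (m + 2) → ℂ)
        + w • (Fin.snoc 0 1 : Fin (m + 2) → ℂ) ∈ expBounded p ν} := by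
      refine fun w hw => ⟨k, fun i => ?_⟩
      rw [← snoc_eq_add_smul]
      exact hk (i, ⟨w, hw⟩)
    obtain ⟨K, hK⟩ := exists_forall_norm_le_pow_on_line hp _ _
      (logCapacity_closedBall_pos.trans_le (logCapacity_mono hcap)) ‖t (Fin.last _)‖
    refine ⟨K, ?_⟩
    rw [ht, snoc_eq_add_smul]
    exact hK _ le_rfl

/-- The locus of exponential boundedness of a family of polynomials with degrees dominated by the
weights has Γ-capacity zero, unless it is everything. -/
theorem mem_expBounded_of_gammaCapacity_ne_zero {m : ℕ} {I : Type*}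
    {p : I → (Fin (m + 1) → ℂ) → ℂ} {ν : I → ℕ} {C : ℕ}
    (hp : ∀ i, p i ∈ lineDegree (m + 1) (C * ν i)) (h : gammaCapacity (expBounded p ν) ≠ 0)
    (t : Fin (m + 1) → ℂ) : t ∈ expBounded p ν := by
  obtain ⟨U, hU⟩ := lt_iSup_iff.1 (pos_iff_ne_zero.2 h)
  set U' : Matrix (Fin (m + 1)) (Fin (m + 1)) ℂ := U.1
  have h1 : star U' * U' = 1 := Matrix.UnitaryGroup.star_mul_self U
  have h2 : U' * star U' = 1 := mul_eq_one_comm.1 h1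
  have himage : (fun t => U'.mulVec t) '' expBounded p ν =
      expBounded (fun i s => p i ((star U').mulVec s)) ν := by
    ext s
    constructor
    · rintro ⟨t, ht, rfl⟩
      simpa [expBounded, Matrix.mulVec_mulVec, h1] using ht
    · intro hs
      exact ⟨(star U').mulVec s, hs, by simp [Matrix.mulVec_mulVec, h2]⟩
  rw [himage] at hU
  have := mem_expBounded_of_gammaProjLine m (fun i s => p i ((star U').mulVec s)) ν C (by
    intro i a b
    obtain ⟨P, hP, hPe⟩ := hp i ((star U').mulVec a) ((star U').mulVec b)
    exact ⟨P, hP, fun w => by simp [← hPe, Matrix.mulVec_add, Matrix.mulVec_smul]⟩) hU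
    (U'.mulVec t)
  simpa [expBounded, Matrix.mulVec_mulVec, h1] using this

/-! ### Homogeneous polynomial maps -/

section HomogeneousMaps

variable {E : Type*} [NormedAddCommGroup E] [NormedSpace ℂ E]

/-- The restriction of a multilinear map to the diagonal, as a linear map. -/
noncomputable def diagonal (k : ℕ) : (E [×k]→L[ℂ] E) →ₗ[ℂ] (E → E) where
  toFun M z := M fun _ => z
  map_add' _ _ := rfl
  map_smul' _ _ := rfl

/-- The space of homogeneous polynomial maps `E → E` of degree `k`: restrictions to the diagonal
of continuous `k`-linear maps. -/
noncomputable def homPoly (E : Type*) [NormedAddCommGroup E] [NormedSpace ℂ E] (k : ℕ) :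
    Submodule ℂ (E → E) := LinearMap.range (diagonal k)

theorem diagonal_apply {k : ℕ} (M : E [×k]→L[ℂ] E) (z : E) : diagonal k M z = M fun _ => z := rfl

theorem diagonal_mem {k : ℕ} (M : E [×k]→L[ℂ] E) : diagonal k M ∈ homPoly E k := ⟨M, rfl⟩

theorem analyticAt_diagonal {k : ℕ} (M : E [×k]→L[ℂ] E) (z : E) :
    AnalyticAt ℂ (diagonal k M) z := by
  set g : E →L[ℂ] Fin k → E := ContinuousLinearMap.pi fun _ => ContinuousLinearMap.id ℂ E
  exact AnalyticAt.comp (g := M) (f := g) M.analyticAt (g.analyticAt z)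

theorem analyticAt_of_mem_homPoly {k : ℕ} {H : E → E} (hH : H ∈ homPoly E k) (z : E) :
    AnalyticAt ℂ H z := by
  obtain ⟨M, rfl⟩ := hH
  exact analyticAt_diagonal M z

theorem differentiableAt_of_mem_homPoly {k : ℕ} {H : E → E} (hH : H ∈ homPoly E k) (z : E) :
    DifferentiableAt ℂ H z := (analyticAt_of_mem_homPoly hH z).differentiableAt

theorem smul_of_mem_homPoly {k : ℕ} {H : E → E} (hH : H ∈ homPoly E k) (c : ℂ) (z : E) :
    H (c • z) = c ^ k • H z := by
  obtain ⟨M, rfl⟩ := hH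
  simpa using! M.map_smul_univ (fun _ => c) (fun _ => z)

theorem fderiv_diagonal {k : ℕ} (M : E [×k]→L[ℂ] E) (z v : E) :
    fderiv ℂ (diagonal k M) z v = ∑ i, M (Function.update (fun _ => z) i v) := by
  set g : E →L[ℂ] Fin k → E := ContinuousLinearMap.pi fun _ => ContinuousLinearMap.id ℂ E
  have h : HasFDerivAt (M ∘ g) ((M.linearDeriv (g z)).comp g) z :=
    (M.hasFDerivAt (g z)).comp z g.hasFDerivAt
  have h' : HasFDerivAt (diagonal k M) ((M.linearDeriv (g z)).comp g) z := h
  rw [h'.fderiv, ContinuousLinearMap.comp_apply, ContinuousMultilinearMap.linearDeriv_apply]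
  rfl

theorem norm_fderiv_diagonal_le {k : ℕ} (M : E [×k]→L[ℂ] E) (z : E) :
    ‖fderiv ℂ (diagonal k M) z‖ ≤ k * ‖M‖ * ‖z‖ ^ (k - 1) := by
  refine ContinuousLinearMap.opNorm_le_bound _ (by positivity) fun v => ?_
  rw [fderiv_diagonal]
  have hle : ∀ i : Fin k, ‖M (Function.update (fun _ => z) i v)‖ ≤
      ‖M‖ * (‖z‖ ^ (k - 1) * ‖v‖) := by
    intro i
    refine (M.le_opNorm _).trans (mul_le_mul_of_nonneg_left (le_of_eq ?_) (norm_nonneg _))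
    rw [← Finset.prod_erase_mul _ _ (Finset.mem_univ i)]
    simp only [Function.update_self]
    congr 1
    rw [Finset.prod_congr rfl (g := fun _ => ‖z‖) fun j hj => by
      rw [Function.update_of_ne (Finset.ne_of_mem_erase hj)]]
    simp
  refine (norm_sum_le_of_le _ fun i _ => hle i).trans (le_of_eq ?_)
  simp only [Finset.sum_const, Finset.card_univ, Fintype.card_fin, nsmul_eq_mul]
  ring

/-- If a power series in one variable vanishes near `0`, then so do its coefficients. -/
theorem eq_zero_of_eventually_hasSum {F : Type*} [NormedAddCommGroup F] [NormedSpace ℂ F]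
    {a : ℕ → F} (h : ∀ᶠ c in 𝓝 (0 : ℂ), HasSum (fun n => c ^ n • a n) 0) (n : ℕ) : a n = 0 := by
  set p : FormalMultilinearSeries ℂ ℂ F :=
    fun n => ContinuousMultilinearMap.mkPiRing ℂ (Fin n) (a n) with hp
  have hcoeff : ∀ n, p.coeff n = a n := fun n => by simp [hp, FormalMultilinearSeries.coeff]
  have hz : HasFPowerSeriesAt (0 : ℂ → F) p 0 := by
    rw [hasFPowerSeriesAt_iff]
    simpa only [hcoeff, Pi.zero_apply] using h
  rw [← hcoeff, hz.eq_zero]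
  rfl

/-- Homogeneous analytic maps are polynomial: only one term of the Taylor series is left. -/
theorem mem_homPoly_of_analyticAt {k : ℕ} {H : E → E} (hH : AnalyticAt ℂ H 0)
    (hs : ∀ c : ℂ, c ≠ 0 → ∀ z, H (c • z) = c ^ k • H z) : H ∈ homPoly E k := by
  -- the case `c = 0` follows by continuity
  have hs' : ∀ (c : ℂ) (z : E), H (c • z) = c ^ k • H z := by
    intro c z
    rcases ne_or_eq c 0 with hc | rfl
    · exact hs c hc z
    have hcont : ContinuousAt (fun c : ℂ => H (c • z)) 0 := by
      refine ContinuousAt.comp' ?_ (by fun_prop)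
      simpa using hH.continuousAt
    have hcont' : ContinuousAt (fun c : ℂ => c ^ k • H z) 0 := by fun_prop
    have h1 := hcont.tendsto.mono_left (nhdsWithin_le_nhds (s := {0}ᶜ))
    have h2 := hcont'.tendsto.mono_left (nhdsWithin_le_nhds (s := {0}ᶜ))
    refine tendsto_nhds_unique h1 (h2.congr' ?_)
    filter_upwards [self_mem_nhdsWithin] with c hc
    exact (hs c hc z).symm
  obtain ⟨p, hp⟩ := hH
  refine ⟨p k, funext fun z => ?_⟩
  have hsum : ∀ᶠ c in 𝓝 (0 : ℂ),
      HasSum (fun n => c ^ n • ((p n fun _ => z) - if n = k then H z else 0)) 0 := by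
    have htend : Filter.Tendsto (fun c : ℂ => c • z) (𝓝 0) (𝓝 0) := by
      have : Continuous fun c : ℂ => c • z := by fun_prop
      simpa using this.tendsto 0
    filter_upwards [htend.eventually hp.eventually_hasSum] with c hc
    have h2 : HasSum (fun n => c ^ n • if n = k then H z else 0) (c ^ k • H z) := by
      convert hasSum_ite_eq k (c ^ k • H z) using 2 with n
      split_ifs with h
      · rw [h]
      · simp
    rw [zero_add, hs'] at hc
    convert hc.sub h2 using 1
    · funext n
      rw [smul_sub]
      congr 1
      simpa using! ((p n).map_smul_univ (fun _ => c) (fun _ => z)).symm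
    · simp
  have := eq_zero_of_eventually_hasSum hsum k
  simpa [sub_eq_zero, diagonal_apply] using this

theorem fderiv_smul_of_mem_homPoly {k : ℕ} {H : E → E} (hH : H ∈ homPoly E (k + 1)) {c : ℂ}
    (hc : c ≠ 0) (z : E) : fderiv ℂ H (c • z) = c ^ k • fderiv ℂ H z := by
  have h1 : HasFDerivAt (fun w => H (c • w)) _ z :=
    HasFDerivAt.comp z (differentiableAt_of_mem_homPoly hH (c • z)).hasFDerivAt
      ((hasFDerivAt_id z).const_smul c)
  have h2 : HasFDerivAt (fun w => H (c • w)) (c ^ (k + 1) • fderiv ℂ H z) z := by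
    simp only [smul_of_mem_homPoly hH]
    exact (differentiableAt_of_mem_homPoly hH z).hasFDerivAt.const_smul _
  have h3 := h1.unique h2
  ext v
  have h4 := congrArg (fun L : E →L[ℂ] E => c⁻¹ • L v) h3
  simpa [smul_smul, pow_succ', hc] using h4

/-- The derivative of a homogeneous map of degree `i + 1` along a homogeneous vector field of
degree `j` is homogeneous of degree `i + j`. -/
theorem fderiv_apply_mem_homPoly [CompleteSpace E] {i j : ℕ} {H X : E → E}
    (hH : H ∈ homPoly E (i + 1)) (hX : X ∈ homPoly E j) :
    (fun z => fderiv ℂ H z (X z)) ∈ homPoly E (i + j) := by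
  refine mem_homPoly_of_analyticAt ?_ fun c hc z => ?_
  · exact ((ContinuousLinearMap.id ℂ (E →L[ℂ] E)).analyticAt_bilinear _).comp₂
      (analyticAt_of_mem_homPoly hH 0).fderiv (analyticAt_of_mem_homPoly hX 0)
  · rw [fderiv_smul_of_mem_homPoly hH hc, smul_of_mem_homPoly hX]
    simp [smul_smul, pow_add, mul_comm]

theorem comp_mem_homPoly (B : E →L[ℂ] E) {k : ℕ} {H : E → E} (hH : H ∈ homPoly E k) :
    (fun z => B (H z)) ∈ homPoly E k := by
  obtain ⟨M, rfl⟩ := hH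
  exact ⟨B.compContinuousMultilinearMap M, rfl⟩

theorem clm_mem_homPoly (B : E →L[ℂ] E) : (fun z => B z) ∈ homPoly E 1 :=
  mem_homPoly_of_analyticAt (B.analyticAt 0) fun c _ z => by simp

/-- The symmetric multilinear map attached to a homogeneous map of degree `k`, namely its `k`-th
derivative at `0` divided by `k!`. -/
noncomputable def polar (k : ℕ) (H : E → E) : E [×k]→L[ℂ] E :=
  ((k.factorial : ℂ)⁻¹) • iteratedFDeriv ℂ k H 0

theorem polar_diagonal_apply {k : ℕ} (M : E [×k]→L[ℂ] E) (v : Fin k → E) :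
    polar k (diagonal k M) v =
      (k.factorial : ℂ)⁻¹ • ∑ σ : Equiv.Perm (Fin k), M fun i => v (σ i) := by
  rw [← M.iteratedFDeriv_comp_diagonal 0 v]
  rfl

theorem diagonal_polar {k : ℕ} {H : E → E} (hH : H ∈ homPoly E k) :
    diagonal k (polar k H) = H := by
  obtain ⟨M, rfl⟩ := hH
  funext z
  rw [diagonal_apply, polar_diagonal_apply, diagonal_apply, Finset.sum_const, Finset.card_univ,
    Fintype.card_perm, Fintype.card_fin, ← Nat.cast_smul_eq_nsmul ℂ, smul_smul, inv_mul_cancel₀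
    (by exact_mod_cast k.factorial_ne_zero), one_smul]

theorem polar_perm {k : ℕ} {H : E → E} (hH : H ∈ homPoly E k) (v : Fin k → E)
    (σ : Equiv.Perm (Fin k)) : polar k H (v ∘ σ) = polar k H v := by
  obtain ⟨M, rfl⟩ := hH
  rw [polar_diagonal_apply, polar_diagonal_apply]
  congr 1
  exact Fintype.sum_equiv (Equiv.mulLeft σ) _ _ fun τ => rfl

theorem norm_polar_diagonal_le {k : ℕ} (M : E [×k]→L[ℂ] E) : ‖polar k (diagonal k M)‖ ≤ ‖M‖ := by
  refine ContinuousMultilinearMap.opNorm_le_bound (norm_nonneg _) fun v => ?_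
  have hfac : (0 : ℝ) < k.factorial := by exact_mod_cast k.factorial_pos
  rw [polar_diagonal_apply, norm_smul, norm_inv, Complex.norm_natCast, inv_mul_le_iff₀ hfac]
  calc ‖∑ σ : Equiv.Perm (Fin k), M fun i => v (σ i)‖
      ≤ ∑ σ : Equiv.Perm (Fin k), ‖M‖ * ∏ i, ‖v i‖ := by
        refine norm_sum_le_of_le _ fun σ _ => (M.le_opNorm _).trans_eq ?_
        rw [Equiv.prod_comp σ fun i => ‖v i‖]
    _ = k.factorial * (‖M‖ * ∏ i, ‖v i‖) := by
        rw [Finset.sum_const, Finset.card_univ, Fintype.card_perm, Fintype.card_fin,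
          nsmul_eq_mul]

/-- A symmetric multilinear map that vanishes on the diagonal is zero. -/
theorem eq_zero_of_diagonal_eq_zero {k : ℕ} {M : E [×k]→L[ℂ] E}
    (hM : ∀ (v : Fin k → E) (σ : Equiv.Perm (Fin k)), M (v ∘ σ) = M v)
    (h : diagonal k M = 0) : M = 0 := by
  ext v
  have hM' : ∀ σ : Equiv.Perm (Fin k), (M fun i => v (σ i)) = M v := hM v
  have h1 := polar_diagonal_apply M v
  simp only [hM'] at h1
  rw [h, Finset.sum_const, Finset.card_univ, Fintype.card_perm, Fintype.card_fin,
    ← Nat.cast_smul_eq_nsmul ℂ, smul_smul, inv_mul_cancel₀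
    (by exact_mod_cast k.factorial_ne_zero), one_smul] at h1
  rw [← h1]
  simp only [polar, smul_apply]
  rw [show (0 : E → E) = fun _ => 0 from rfl, iteratedFDeriv_fun_zero]
  simp

theorem continuousMultilinearMap_finiteDimensional [FiniteDimensional ℂ E] (k : ℕ) :
    FiniteDimensional ℂ (E [×k]→L[ℂ] E) :=
  Module.Finite.of_injective
    (ContinuousMultilinearMap.toMultilinearMapLinear (R' := ℂ) (A := ℂ)
      (M₁ := fun _ : Fin k => E) (M₂ := E))
    ContinuousMultilinearMap.toMultilinearMap_injective

theorem finiteDimensional_homPoly [FiniteDimensional ℂ E] (k : ℕ) :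
    FiniteDimensional ℂ (homPoly E k) := by
  have := continuousMultilinearMap_finiteDimensional (E := E) k
  exact LinearMap.finiteDimensional_range (diagonal (E := E) k)

/-! ### The homological equation -/

/-- The eigenvalues of `A` have no resonance of order `k`: no sum of `k` eigenvalues is an
eigenvalue. -/
def NoResonance (A : E →L[ℂ] E) (k : ℕ) : Prop :=
  ∀ μ : Fin k → ℂ, (∀ i, Module.End.HasEigenvalue (A : E →ₗ[ℂ] E) (μ i)) →
    ¬ Module.End.HasEigenvalue (A : E →ₗ[ℂ] E) (∑ i, μ i)

/-- A multilinear map that intertwines the action of `A` on tuples with `A` vanishes on tuples of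
generalized eigenvectors, by induction on the total order of these. -/
theorem apply_eq_zero_of_genEigenvectors {A : E →L[ℂ] E} {k : ℕ} (hA : NoResonance A k)
    {M : E [×k]→L[ℂ] E} (hM : ∀ v, ∑ i, M (Function.update v i (A (v i))) = A (M v))
    (μ : Fin k → ℂ) : ∀ (N : ℕ) (r : Fin k → ℕ) (v : Fin k → E), ∑ i, r i = N →
      (∀ i, (((A : E →ₗ[ℂ] E) - μ i • (1 : Module.End ℂ E)) ^ r i) (v i) = 0) → M v = 0 := by
  intro N
  induction N with
  | zero =>
    intro r v hr hv
    have hr0 : ∀ i, r i = 0 := by simpa using hr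
    by_contra hne
    have hk : ¬ ∃ i, v i = 0 := fun ⟨i, hi⟩ => hne (M.map_coord_zero i hi)
    rcases isEmpty_or_nonempty (Fin k) with he | ⟨⟨i⟩⟩
    · refine hA μ (fun i => he.elim i) ?_
      refine Module.End.hasEigenvalue_of_hasEigenvector (x := M v)
        (Module.End.hasEigenvector_iff.2 ⟨Module.End.mem_eigenspace_iff.2 ?_, hne⟩)
      have := hM v
      simp only [Finset.univ_eq_empty, Finset.sum_empty] at this ⊢
      simpa using! this.symm
    · exact hk ⟨i, by simpa [hr0 i] using hv i⟩
  | succ N ih =>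
    intro r v hr hv
    by_contra hne
    have hv0 : ∀ i, v i ≠ 0 := fun i hi => hne (M.map_coord_zero i hi)
    have hr0 : ∀ i, r i ≠ 0 := fun i hi => hv0 i (by simpa [hi] using hv i)
    refine hA μ (fun i => ?_) ?_
    · refine Module.End.hasEigenvalue_of_hasGenEigenvalue (k := r i) fun hbot => hv0 i ?_
      rw [← Submodule.mem_bot ℂ, ← hbot]
      exact Module.End.mem_genEigenspace_nat.2 (hv i)
    refine Module.End.hasEigenvalue_of_hasEigenvector (x := M v)
      (Module.End.hasEigenvector_iff.2 ⟨Module.End.mem_eigenspace_iff.2 ?_, hne⟩)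
    change A (M v) = _
    rw [← hM v, Finset.sum_smul]
    refine Finset.sum_congr rfl fun i _ => ?_
    -- `A - μ i` lowers the order of the generalized eigenvector `v i`
    have hz : M (Function.update v i (A (v i) - μ i • v i)) = 0 := by
      refine ih (Function.update r i (r i - 1)) _ ?_ fun j => ?_
      · rw [Finset.sum_update_of_mem (Finset.mem_univ i)]
        rw [← Finset.add_sum_erase _ _ (Finset.mem_univ i)] at hr
        rw [← Finset.erase_eq]
        have := hr0 i
        omega
      · rcases eq_or_ne j i with rfl | hj
        · simp only [Function.update_self]
          rw [← hv j]
          conv_rhs => rw [← Nat.succ_pred_eq_of_ne_zero (hr0 j), pow_succ]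
          rfl
        · simp only [Function.update_of_ne hj]
          exact hv j
    rw [M.map_update_sub, M.map_update_smul, Function.update_eq_self, sub_eq_zero] at hz
    exact hz

/-- A multilinear map vanishing on tuples from a spanning set is zero. -/
theorem apply_eq_zero_of_span_eq_top {k : ℕ} {M : E [×k]→L[ℂ] E} {S : Set E}
    (hS : Submodule.span ℂ S = ⊤) (h : ∀ v, (∀ i, v i ∈ S) → M v = 0) (v : Fin k → E) :
    M v = 0 := by
  have key : ∀ (s : Finset (Fin k)) (v : Fin k → E), (∀ i ∉ s, v i ∈ S) → M v = 0 := by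
    intro s
    induction s using Finset.induction_on with
    | empty => exact fun v hv => h v fun i => hv i (by simp)
    | insert a s ha ih =>
      intro v hv
      have : ∀ x, M (Function.update v a x) = 0 := by
        intro x
        have hx : x ∈ Submodule.span ℂ S := hS ▸ Submodule.mem_top
        induction hx using Submodule.span_induction with
        | mem x hx =>
          refine ih _ fun i hi => ?_
          rcases eq_or_ne i a with rfl | hia
          · simpa using hx
          · rw [Function.update_of_ne hia]
            exact hv i (by simp [hia, hi])
        | zero => exact M.map_coord_zero a (by simp)
        | add x y _ _ hx hy => rw [M.map_update_add, hx, hy, add_zero]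
        | smul c x _ hx => rw [M.map_update_smul, hx, smul_zero]
      simpa using this (v a)
  exact key Finset.univ v fun i hi => absurd (Finset.mem_univ i) hi

theorem eq_zero_of_intertwines [FiniteDimensional ℂ E] {A : E →L[ℂ] E} {k : ℕ}
    (hA : NoResonance A k) {M : E [×k]→L[ℂ] E}
    (hM : ∀ v, ∑ i, M (Function.update v i (A (v i))) = A (M v)) : M = 0 := by
  set S : Set E := {v | ∃ (μ : ℂ) (r : ℕ),
    (((A : E →ₗ[ℂ] E) - μ • (1 : Module.End ℂ E)) ^ r) v = 0} with hSdef
  have hS : Submodule.span ℂ S = ⊤ := by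
    rw [eq_top_iff, ← Module.End.iSup_maxGenEigenspace_eq_top (A : E →ₗ[ℂ] E), iSup_le_iff]
    intro μ v hv
    exact Submodule.subset_span ⟨μ, (Module.End.mem_maxGenEigenspace _ _ _).1 hv⟩
  ext v
  refine apply_eq_zero_of_span_eq_top hS (fun v hv => ?_) v
  choose μ r hr using hv
  exact apply_eq_zero_of_genEigenvectors hA hM μ _ r v rfl hr

/-- Uniqueness for the homological equation `DH(z) A z = A H(z)` in a non-resonant degree. -/
theorem eq_zero_of_fderiv_eq [FiniteDimensional ℂ E] {A : E →L[ℂ] E} {k : ℕ}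
    (hA : NoResonance A k) {H : E → E} (hH : H ∈ homPoly E k)
    (h : ∀ z, fderiv ℂ H z (A z) = A (H z)) : H = 0 := by
  set M := polar k H
  set B : E [×k]→L[ℂ] E := (∑ i, M.compContinuousLinearMap fun j =>
    if j = i then A else ContinuousLinearMap.id ℂ E) - A.compContinuousMultilinearMap M with hB
  have hBapply : ∀ v, B v = ∑ i, M (Function.update v i (A (v i))) - A (M v) := by
    intro v
    simp only [hB, sub_apply, sum_apply,
      ContinuousMultilinearMap.compContinuousLinearMap_apply,
      ContinuousLinearMap.compContinuousMultilinearMap_coe, Function.comp_apply]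
    congr 1
    refine Finset.sum_congr rfl fun i _ => ?_
    congr 1
    ext j
    rcases eq_or_ne j i with rfl | hj
    · simp
    · simp [hj]
  have hMH : diagonal k M = H := diagonal_polar hH
  have hB0 : B = 0 := by
    refine eq_zero_of_diagonal_eq_zero (fun v σ => ?_) ?_
    · rw [hBapply, hBapply, polar_perm hH v σ]
      congr 1
      refine Fintype.sum_equiv σ _ _ fun i => ?_
      rw [← polar_perm hH (Function.update v (σ i) _) σ, Function.update_comp_equiv,
        Equiv.symm_apply_apply]
      rfl
    · funext z
      rw [diagonal_apply, hBapply, ← fderiv_diagonal, hMH, h z, ← diagonal_apply M z, hMH]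
      simp
  have hM0 : M = 0 := eq_zero_of_intertwines hA fun v => by
    rw [← sub_eq_zero, ← hBapply, hB0]
    rfl
  rw [← hMH, hM0, map_zero]

/-- Existence for the homological equation in a non-resonant degree: a linear solution operator,
arbitrarily extended from homogeneous maps to all maps. -/
theorem exists_homological_inverse [FiniteDimensional ℂ E] {A : E →L[ℂ] E} {k : ℕ}
    (hA : NoResonance A (k + 1)) : ∃ L : (E → E) →ₗ[ℂ] (E → E), ∀ G ∈ homPoly E (k + 1),
      L G ∈ homPoly E (k + 1) ∧ ∀ z, fderiv ℂ (L G) z (A z) - A (L G z) = G z := by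
  have := FiniteDimensional.complete ℂ E
  have := finiteDimensional_homPoly (E := E) (k + 1)
  set T : homPoly E (k + 1) →ₗ[ℂ] homPoly E (k + 1) :=
    { toFun := fun H => ⟨fun z => fderiv ℂ H.1 z (A z) - A (H.1 z),
        Submodule.sub_mem _ (fderiv_apply_mem_homPoly H.2 (clm_mem_homPoly A))
          (comp_mem_homPoly A H.2)⟩
      map_add' := fun H H' => by
        ext1
        funext z
        simp only [Submodule.coe_add, Pi.add_apply, map_add]
        rw [fderiv_add (differentiableAt_of_mem_homPoly H.2 z)
          (differentiableAt_of_mem_homPoly H'.2 z), add_apply]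
        abel
      map_smul' := fun c H => by
        ext1
        funext z
        simp only [Submodule.coe_smul, Pi.smul_apply, map_smul, RingHom.id_apply]
        rw [fderiv_const_smul (differentiableAt_of_mem_homPoly H.2 z), smul_apply,
          smul_sub] } with hT
  have hinj : Function.Injective T := by
    refine (injective_iff_map_eq_zero T).2 fun H hH => Subtype.ext ?_
    refine eq_zero_of_fderiv_eq hA H.2 fun z => ?_
    have := congrFun (congrArg Subtype.val hH) z
    exact sub_eq_zero.1 this
  obtain ⟨L, hL⟩ := LinearMap.exists_extend
    ((homPoly E (k + 1)).subtype ∘ₗ (LinearEquiv.ofInjectiveEndo T hinj).symm.toLinearMap)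
  refine ⟨L, fun G hG => ?_⟩
  have hLG : L G = ((LinearEquiv.ofInjectiveEndo T hinj).symm ⟨G, hG⟩).1 :=
    LinearMap.congr_fun hL ⟨G, hG⟩
  refine ⟨hLG ▸ Subtype.property _, fun z => ?_⟩
  have h1 : T ((LinearEquiv.ofInjectiveEndo T hinj).symm ⟨G, hG⟩) = ⟨G, hG⟩ :=
    (LinearEquiv.ofInjectiveEndo T hinj).apply_symm_apply _
  have := congrFun (congrArg Subtype.val h1) z
  rw [hLG]
  exact this

end HomogeneousMaps

section Expansions

open Finset.HasAntidiagonal (antidiagonal)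

variable {E : Type*} [NormedAddCommGroup E] [NormedSpace ℂ E]

/-! ### Homogeneous expansions -/

/-- The map `h` is analytic at `0`, and `G k` is the homogeneous part of degree `k` of its Taylor
series. -/
def HasHomExpansion (h : E → E) (G : ℕ → E → E) : Prop :=
  ∃ M : FormalMultilinearSeries ℂ E E, HasFPowerSeriesAt h M 0 ∧ ∀ k, G k = diagonal k (M k)

namespace HasHomExpansion

variable {h h' : E → E} {G G' : ℕ → E → E}

theorem mem_homPoly (hG : HasHomExpansion h G) (k : ℕ) : G k ∈ homPoly E k := by
  obtain ⟨M, -, hM⟩ := hG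
  exact hM k ▸ diagonal_mem _

theorem add (hG : HasHomExpansion h G) (hG' : HasHomExpansion h' G') :
    HasHomExpansion (fun z => h z + h' z) fun k z => G k z + G' k z := by
  obtain ⟨M, hM, h1⟩ := hG
  obtain ⟨M', hM', h1'⟩ := hG'
  obtain rfl : G = fun k => diagonal k (M k) := funext h1
  obtain rfl : G' = fun k => diagonal k (M' k) := funext h1'
  exact ⟨M + M', hM.add hM', fun _ => rfl⟩

theorem const_smul (hG : HasHomExpansion h G) (c : ℂ) :
    HasHomExpansion (fun z => c • h z) fun k z => c • G k z := by
  obtain ⟨M, hM, h1⟩ := hG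
  obtain rfl : G = fun k => diagonal k (M k) := funext h1
  exact ⟨c • M, hM.const_smul, fun _ => rfl⟩

theorem clm (B : E →L[ℂ] E) :
    HasHomExpansion (fun z => B z) fun k z => if k = 1 then B z else 0 := by
  refine ⟨B.fpowerSeries 0, B.hasFPowerSeriesAt 0, fun k => ?_⟩
  funext z
  rcases k with _ | _ | k
  · simp [diagonal_apply]
  · simp [diagonal_apply]
  · simp [diagonal_apply]

theorem zero : HasHomExpansion (fun _ : E => (0 : E)) fun _ _ => 0 := by
  simpa using clm (0 : E →L[ℂ] E)

theorem sum {ι : Type*} (s : Finset ι) {h : ι → E → E} {G : ι → ℕ → E → E}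
    (hG : ∀ i ∈ s, HasHomExpansion (h i) (G i)) :
    HasHomExpansion (fun z => ∑ i ∈ s, h i z) fun k z => ∑ i ∈ s, G i k z := by
  classical
  induction s using Finset.induction_on with
  | empty => simpa using zero
  | insert a s ha ih =>
    simp only [Finset.sum_insert ha]
    exact (hG a (by simp)).add (ih fun i hi => hG i (by simp [hi]))

theorem coeff_zero_apply (hG : HasHomExpansion h G) (z : E) : G 0 z = h 0 := by
  obtain ⟨M, hM, h1⟩ := hG
  rw [h1, diagonal_apply, hM.coeff_zero]

theorem coeff_one_apply (hG : HasHomExpansion h G) (z : E) : G 1 z = fderiv ℂ h 0 z := by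
  obtain ⟨M, hM, h1⟩ := hG
  rw [h1, diagonal_apply, hM.hasFDerivAt.fderiv]
  rfl

/-- Near `0` the homogeneous parts and their derivatives are absolutely summable, with sums the
map and its derivative. -/
theorem eventually_hasSum [CompleteSpace E] (hG : HasHomExpansion h G) :
    ∀ᶠ z in 𝓝 (0 : E), HasSum (fun k => G k z) (h z) ∧ Summable (fun k => ‖G k z‖) ∧
      HasSum (fun k => fderiv ℂ (G (k + 1)) z) (fderiv ℂ h z) ∧
      Summable fun k => ‖fderiv ℂ (G (k + 1)) z‖ := by
  obtain ⟨M, hM, h1⟩ := hG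
  obtain rfl : G = fun k => diagonal k (M k) := funext h1
  have hsum : ∀ᶠ z in 𝓝 (0 : E), HasSum (fun k => diagonal k (M k) z) (h z) := by
    simpa only [zero_add] using! hM.eventually_hasSum
  obtain ⟨C, r, hC, hr, hb⟩ := M.le_mul_pow_of_radius_pos hM.radius_pos
  -- on the ball of radius `ρ` all the series are dominated by geometric ones of ratio `1 / 2`
  set ρ : ℝ := (2 * r)⁻¹
  have hρ : 0 < ρ := by positivity
  have hrρ : r * ρ = 2⁻¹ := by
    simp only [ρ]
    field_simp
  set u : ℕ → ℝ := fun k => C / ρ * ((k : ℝ) * (2⁻¹ : ℝ) ^ k) with hu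
  have hus : Summable u := by
    have := summable_pow_mul_geometric_of_norm_lt_one 1 (r := (2⁻¹ : ℝ)) (by norm_num)
    simpa only [pow_one] using this.mul_left (C / ρ)
  have hder : ∀ k, ∀ z ∈ Metric.ball (0 : E) ρ, ‖fderiv ℂ (diagonal k (M k)) z‖ ≤ u k := by
    intro k z hz
    rw [mem_ball_zero_iff] at hz
    refine (norm_fderiv_diagonal_le _ _).trans ?_
    rcases k with _ | k
    · simp [hu]
    · calc ((k + 1 : ℕ) : ℝ) * ‖M (k + 1)‖ * ‖z‖ ^ (k + 1 - 1)
          ≤ ((k + 1 : ℕ) : ℝ) * (C * r ^ (k + 1)) * ρ ^ k := by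
            rw [Nat.add_sub_cancel]
            gcongr
            exact hb _
        _ = u (k + 1) := by
            simp only [hu]
            rw [← hrρ, mul_pow, pow_succ ρ k]
            field_simp
  have hball : Metric.ball (0 : E) ρ ∈ 𝓝 (0 : E) := Metric.ball_mem_nhds _ hρ
  have heq : h =ᶠ[𝓝 0] fun z => ∑' k, diagonal k (M k) z := by
    filter_upwards [hsum] with z hz using hz.tsum_eq.symm
  filter_upwards [hsum, heq.eventually_nhds, hball] with z hz hez hzb
  have hfd := hasFDerivAt_tsum_of_isPreconnected hus Metric.isOpen_ball
    (convex_ball (0 : E) ρ).isPreconnected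
    (fun k z _ => (analyticAt_diagonal (M k) z).differentiableAt.hasFDerivAt) hder
    (Metric.mem_ball_self hρ) hsum.self_of_nhds.summable hzb
  have hnorm : Summable fun k => ‖fderiv ℂ (diagonal k (M k)) z‖ :=
    Summable.of_nonneg_of_le (fun _ => norm_nonneg _) (fun k => hder k z hzb) hus
  refine ⟨hz, ?_, ?_, (summable_nat_add_iff 1).2 hnorm⟩
  · refine Summable.of_nonneg_of_le (fun _ => norm_nonneg _) (fun k => ?_)
      ((summable_geometric_of_lt_one (by norm_num) (by norm_num : (2⁻¹ : ℝ) < 1)).mul_left C)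
    rw [mem_ball_zero_iff] at hzb
    calc ‖diagonal k (M k) z‖ ≤ ‖M k‖ * ‖z‖ ^ k := by
          simpa [diagonal_apply] using (M k).le_opNorm fun _ => z
      _ ≤ (C * r ^ k) * ρ ^ k := by
          gcongr
          exact hb _
      _ = C * 2⁻¹ ^ k := by rw [← hrρ, mul_pow, mul_assoc]
  · have h0 : fderiv ℂ (diagonal 0 (M 0)) z = 0 := by
      ext v
      simp [fderiv_diagonal]
    have h2 := (hasSum_nat_add_iff' (f := fun k => fderiv ℂ (diagonal k (M k)) z) 1).2
      hnorm.of_norm.hasSum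
    simp only [Finset.sum_range_one, h0, sub_zero] at h2
    rwa [Filter.EventuallyEq.fderiv_eq hez, hfd.fderiv]

end HasHomExpansion

/-- The Cauchy product of an absolutely convergent series of operators with an absolutely
convergent series of vectors. -/
theorem hasSum_sum_antidiagonal_apply [CompleteSpace E] {a : ℕ → E →L[ℂ] E} {b : ℕ → E}
    {a₀ : E →L[ℂ] E} {b₀ : E} (ha : HasSum a a₀) (hb : HasSum b b₀)
    (ha' : Summable fun i => ‖a i‖) (hb' : Summable fun j => ‖b j‖) :
    HasSum (fun n => ∑ p ∈ antidiagonal n, a p.1 (b p.2)) (a₀ b₀) := by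
  have hs : Summable fun p : ℕ × ℕ => a p.1 (b p.2) :=
    Summable.of_norm_bounded (ha'.mul_of_nonneg hb' (fun _ => norm_nonneg _)
      fun _ => norm_nonneg _) fun p => (a p.1).le_opNorm _
  have h1 : HasSum (fun i => a i b₀) (∑' p : ℕ × ℕ, a p.1 (b p.2)) :=
    hs.hasSum.prod_fiberwise fun i => (a i).hasSum hb
  have h2 : HasSum (fun i => a i b₀) (a₀ b₀) :=
    (ContinuousLinearMap.apply ℂ E b₀).hasSum ha
  have h3 : HasSum (fun p : ℕ × ℕ => a p.1 (b p.2)) (a₀ b₀) := h1.unique h2 ▸ hs.hasSum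
  have h4 := (Finset.HasAntidiagonal.sigmaAntidiagonalEquivProd (A := ℕ)).hasSum_iff.2 h3
  refine h4.sigma fun n => ?_
  convert hasSum_fintype _ using 1
  exact (Finset.sum_coe_sort (antidiagonal n) fun p => a p.1 (b p.2)).symm

/-- The coefficients of the conjugacy equation `Dh(z) X(z) = A h(z)`: `G` and `x` are the
homogeneous parts of `h` and `X`. -/
def SolvesFormally (A : E →L[ℂ] E) (x G : ℕ → E → E) : Prop :=
  ∀ n z, ∑ p ∈ antidiagonal n, fderiv ℂ (G (p.1 + 1)) z (x p.2 z) = A (G n z)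

theorem solvesFormally_iff_eventually_eq [CompleteSpace E] {A : E →L[ℂ] E} {h X : E → E}
    {G x : ℕ → E → E} (hG : HasHomExpansion h G) (hx : HasHomExpansion X x) :
    SolvesFormally A x G ↔ ∀ᶠ z in 𝓝 (0 : E), fderiv ℂ h z (X z) = A (h z) := by
  have hlhs : ∀ᶠ z in 𝓝 (0 : E), HasSum
      (fun n => ∑ p ∈ antidiagonal n, fderiv ℂ (G (p.1 + 1)) z (x p.2 z))
      (fderiv ℂ h z (X z)) := by
    filter_upwards [hG.eventually_hasSum, hx.eventually_hasSum] with z h1 h2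
    exact hasSum_sum_antidiagonal_apply (a := fun k => fderiv ℂ (G (k + 1)) z)
      (b := fun j => x j z) h1.2.2.1 h2.1 h1.2.2.2 h2.2.1
  have hrhs : ∀ᶠ z in 𝓝 (0 : E), HasSum (fun n => A (G n z)) (A (h z)) := by
    filter_upwards [hG.eventually_hasSum] with z h1 using A.hasSum h1.1
  constructor
  · intro hs
    filter_upwards [hlhs, hrhs] with z h1 h2
    simp only [hs _ z] at h1
    exact h1.unique h2
  · intro hev n z
    set Q : ℕ → E → E := fun n z =>
      ∑ p ∈ antidiagonal n, fderiv ℂ (G (p.1 + 1)) z (x p.2 z) - A (G n z) with hQ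
    have hQmem : ∀ n, Q n ∈ homPoly E n := by
      intro n
      refine Submodule.sub_mem _ ?_ (comp_mem_homPoly A (hG.mem_homPoly n))
      have : (fun z => ∑ p ∈ antidiagonal n, fderiv ℂ (G (p.1 + 1)) z (x p.2 z)) =
          ∑ p ∈ antidiagonal n, fun z => fderiv ℂ (G (p.1 + 1)) z (x p.2 z) := by
        funext z
        simp
      rw [this]
      refine Submodule.sum_mem _ fun p hp => ?_
      rw [← Finset.HasAntidiagonal.mem_antidiagonal.1 hp]
      exact fderiv_apply_mem_homPoly (hG.mem_homPoly _) (hx.mem_homPoly _)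
    have htend : Filter.Tendsto (fun c : ℂ => c • z) (𝓝 0) (𝓝 0) := by
      have : Continuous fun c : ℂ => c • z := by fun_prop
      simpa using this.tendsto 0
    have hsum : ∀ᶠ c in 𝓝 (0 : ℂ), HasSum (fun n => c ^ n • Q n z) 0 := by
      filter_upwards [htend.eventually (hev.and (hlhs.and hrhs))] with c ⟨h1, h2, h3⟩
      have h4 := h2.sub h3
      rw [h1, sub_self] at h4
      simpa only [← smul_of_mem_homPoly (hQmem _)] using h4
    exact sub_eq_zero.1 (eq_zero_of_eventually_hasSum hsum n)

/-! ### The formal linearization -/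

/-- In degree `k + 2`, the formal conjugacy equation is the homological equation for `G (k + 2)`,
with a right-hand side determined by the terms of lower degree. -/
theorem sum_antidiagonal_eq_iff {A : E →L[ℂ] E} {x G : ℕ → E → E} (hx0 : x 0 = 0)
    (hx1 : x 1 = fun z => A z) (k : ℕ) (z : E) :
    (∑ p ∈ antidiagonal (k + 2), fderiv ℂ (G (p.1 + 1)) z (x p.2 z) = A (G (k + 2) z)) ↔
      fderiv ℂ (G (k + 2)) z (A z) - A (G (k + 2) z) =
        -∑ i ∈ Finset.range (k + 1), fderiv ℂ (G (i + 1)) z (x (k + 2 - i) z) := by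
  rw [Finset.Nat.sum_antidiagonal_eq_sum_range_succ
    (fun i j => fderiv ℂ (G (i + 1)) z (x j z)), Finset.sum_range_succ, Finset.sum_range_succ]
  have h1 : k + 2 - (k + 1) = 1 := by omega
  simp only [h1, hx1, Nat.sub_self, hx0, Pi.zero_apply, map_zero, add_zero]
  rw [sub_eq_iff_eq_add, eq_comm (a := fderiv ℂ (G (k + 2)) z (A z)), neg_add_eq_iff_eq_add,
    eq_comm]

theorem SolvesFormally.unique [FiniteDimensional ℂ E] {A : E →L[ℂ] E}
    (hA : ∀ k, NoResonance A (k + 2)) {x G G' : ℕ → E → E} (hx0 : x 0 = 0)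
    (hx1 : x 1 = fun z => A z) (hG : ∀ k, G k ∈ homPoly E k) (hG' : ∀ k, G' k ∈ homPoly E k)
    (hs : SolvesFormally A x G) (hs' : SolvesFormally A x G') (h0 : G 0 = G' 0)
    (h1 : G 1 = G' 1) (n : ℕ) : G n = G' n := by
  induction n using Nat.strong_induction_on with
  | _ n ih =>
    rcases n with _ | _ | k
    · exact h0
    · exact h1
    rw [← sub_eq_zero]
    refine eq_zero_of_fderiv_eq (hA k) (Submodule.sub_mem _ (hG _) (hG' _)) fun z => ?_
    have e := (sum_antidiagonal_eq_iff hx0 hx1 k z).1 (hs _ z)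
    have e' := (sum_antidiagonal_eq_iff hx0 hx1 k z).1 (hs' _ z)
    rw [Finset.sum_congr rfl fun i hi => by
      rw [ih (i + 1) (by have := Finset.mem_range.1 hi; omega)], ← e'] at e
    rw [fderiv_sub (differentiableAt_of_mem_homPoly (hG _) z)
      (differentiableAt_of_mem_homPoly (hG' _) z), sub_apply, Pi.sub_apply, map_sub]
    rw [sub_eq_sub_iff_sub_eq_sub] at e
    exact e

/-- The homogeneous parts of the formal linearization tangent to the identity of the vector field
with homogeneous parts `x`, where `L k` solves the homological equation in degree `k`. -/
noncomputable def formalLinearization (L : ℕ → (E → E) →ₗ[ℂ] (E → E)) (x : ℕ → E → E) :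
    ℕ → E → E
  | 0 => 0
  | 1 => fun z => z
  | k + 2 => L (k + 2) fun z =>
      -∑ i : Fin (k + 1), fderiv ℂ (formalLinearization L x (i + 1)) z (x (k + 2 - i) z)

section FormalLinearization

variable {L : ℕ → (E → E) →ₗ[ℂ] (E → E)} {x : ℕ → E → E} {A : E →L[ℂ] E}

theorem formalLinearization_rhs_mem [CompleteSpace E] (hx : ∀ k, x k ∈ homPoly E k) {k : ℕ}
    {H : ℕ → E → E} (hH : ∀ i ≤ k, H (i + 1) ∈ homPoly E (i + 1)) :
    (fun z => -∑ i : Fin (k + 1), fderiv ℂ (H (i + 1)) z (x (k + 2 - i) z)) ∈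
      homPoly E (k + 2) := by
  have : (fun z => -∑ i : Fin (k + 1), fderiv ℂ (H (i + 1)) z (x (k + 2 - i) z)) =
      -∑ i : Fin (k + 1), fun z => fderiv ℂ (H (i + 1)) z (x (k + 2 - i) z) := by
    funext z
    simp
  rw [this]
  refine Submodule.neg_mem _ (Submodule.sum_mem _ fun i _ => ?_)
  have hi : (i : ℕ) + (k + 2 - i) = k + 2 := by omega
  have := fderiv_apply_mem_homPoly (hH i (by omega)) (hx (k + 2 - i))
  rwa [hi] at this

theorem formalLinearization_mem [CompleteSpace E] (hx : ∀ k, x k ∈ homPoly E k)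
    (hL : ∀ k, ∀ G ∈ homPoly E (k + 2), L (k + 2) G ∈ homPoly E (k + 2)) (n : ℕ) :
    formalLinearization L x n ∈ homPoly E n := by
  induction n using Nat.strong_induction_on with
  | _ n ih =>
    rcases n with _ | _ | k
    · rw [formalLinearization]
      exact Submodule.zero_mem _
    · rw [zero_add, formalLinearization]
      exact clm_mem_homPoly (ContinuousLinearMap.id ℂ E)
    · rw [formalLinearization]
      exact hL k _ (formalLinearization_rhs_mem hx fun i hi => ih _ (by omega))

theorem formalLinearization_solves [CompleteSpace E] (hx : ∀ k, x k ∈ homPoly E k)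
    (hx0 : x 0 = 0) (hx1 : x 1 = fun z => A z)
    (hL : ∀ k, ∀ G ∈ homPoly E (k + 2), L (k + 2) G ∈ homPoly E (k + 2) ∧
      ∀ z, fderiv ℂ (L (k + 2) G) z (A z) - A (L (k + 2) G z) = G z) :
    SolvesFormally A x (formalLinearization L x) := by
  intro n z
  rcases n with _ | _ | k
  · simp [hx0, formalLinearization]
  · simp [Finset.Nat.antidiagonal_succ, hx0, hx1, formalLinearization]
  · rw [sum_antidiagonal_eq_iff hx0 hx1]
    have hmem := formalLinearization_mem hx fun k G hG => (hL k G hG).1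
    have := (hL k _ (formalLinearization_rhs_mem (k := k) hx fun i _ => hmem (i + 1))).2 z
    rw [Finset.sum_range fun i => fderiv ℂ (formalLinearization L x (i + 1)) z (x (k + 2 - i) z)]
    rw [formalLinearization]
    exact this

end FormalLinearization

end Expansions

/-! ### Polynomial dependence on the parameters -/

section Parameters

variable {E : Type*} [NormedAddCommGroup E] [NormedSpace ℂ E] {m : ℕ}

/-- Families of homogeneous maps of degree `k` that depend polynomially, with degree at most `N`
on each complex line, on a parameter in `ℂ^m`. -/
def polyMaps (E : Type*) [NormedAddCommGroup E] [NormedSpace ℂ E] (m k N : ℕ) :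
    Submodule ℂ ((Fin m → ℂ) → E → E) :=
  Submodule.span ℂ {u | ∃ φ ∈ lineDegree m N, ∃ H ∈ homPoly E k, u = fun t => φ t • H}

theorem smul_mem_polyMaps {k N : ℕ} {φ : (Fin m → ℂ) → ℂ} (hφ : φ ∈ lineDegree m N)
    {H : E → E} (hH : H ∈ homPoly E k) : (fun t => φ t • H) ∈ polyMaps E m k N :=
  Submodule.subset_span ⟨φ, hφ, H, hH, rfl⟩

theorem const_mem_polyMaps {k : ℕ} (N : ℕ) {H : E → E} (hH : H ∈ homPoly E k) :
    (fun _ => H) ∈ polyMaps E m k N := by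
  simpa using smul_mem_polyMaps (one_mem_lineDegree m N) hH

theorem polyMaps_mono (k : ℕ) : Monotone (polyMaps E m k) := by
  intro N N' hN
  refine Submodule.span_mono ?_
  rintro u ⟨φ, hφ, H, hH, rfl⟩
  exact ⟨φ, lineDegree_mono m hN hφ, H, hH, rfl⟩

theorem mem_homPoly_of_mem_polyMaps {k N : ℕ} {u : (Fin m → ℂ) → E → E}
    (hu : u ∈ polyMaps E m k N) (t : Fin m → ℂ) : u t ∈ homPoly E k := by
  induction hu using Submodule.span_induction with
  | mem u hu =>
    obtain ⟨φ, -, H, hH, rfl⟩ := hu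
    exact Submodule.smul_mem _ _ hH
  | zero => exact Submodule.zero_mem _
  | add u v _ _ hu hv => exact Submodule.add_mem _ hu hv
  | smul c u _ hu => exact Submodule.smul_mem _ _ hu

theorem fderiv_apply_mem_polyMaps [CompleteSpace E] {i j N N' : ℕ} {u v : (Fin m → ℂ) → E → E}
    (hu : u ∈ polyMaps E m (i + 1) N) (hv : v ∈ polyMaps E m j N') :
    (fun t z => fderiv ℂ (u t) z (v t z)) ∈ polyMaps E m (i + j) (N + N') := by
  have hd : ∀ u ∈ polyMaps E m (i + 1) N, ∀ t z, DifferentiableAt ℂ (u t) z := fun u hu t z =>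
    differentiableAt_of_mem_homPoly (mem_homPoly_of_mem_polyMaps hu t) z
  induction hu, hv using Submodule.span_induction₂ with
  | mem_mem u v hu hv =>
    obtain ⟨φ, hφ, H, hH, rfl⟩ := hu
    obtain ⟨ψ, hψ, X, hX, rfl⟩ := hv
    convert smul_mem_polyMaps (mul_mem_lineDegree hφ hψ) (fderiv_apply_mem_homPoly hH hX)
      using 1
    funext t z
    rw [fderiv_const_smul (differentiableAt_of_mem_homPoly hH z)]
    simp [smul_smul, mul_comm]
  | zero_left v hv =>
    convert Submodule.zero_mem _ using 1
    funext t z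
    simp
  | zero_right u hu =>
    convert Submodule.zero_mem _ using 1
    funext t z
    simp
  | add_left u u' v hu hu' hv h h' =>
    convert Submodule.add_mem _ h h' using 1
    funext t z
    simp only [Pi.add_apply]
    rw [fderiv_add (hd u hu t z) (hd u' hu' t z), add_apply]
  | add_right u v v' hu hv hv' h h' =>
    convert Submodule.add_mem _ h h' using 1
    funext t z
    simp
  | smul_left c u v hu hv h =>
    convert Submodule.smul_mem _ c h using 1
    funext t z
    simp only [Pi.smul_apply]
    rw [fderiv_const_smul (hd u hu t z), smul_apply]
  | smul_right c u v hu hv h =>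
    convert Submodule.smul_mem _ c h using 1
    funext t z
    simp

theorem linearMap_apply_mem_polyMaps {k N : ℕ} {L : (E → E) →ₗ[ℂ] (E → E)}
    (hL : ∀ G ∈ homPoly E k, L G ∈ homPoly E k) {u : (Fin m → ℂ) → E → E}
    (hu : u ∈ polyMaps E m k N) : (fun t => L (u t)) ∈ polyMaps E m k N := by
  induction hu using Submodule.span_induction with
  | mem u hu =>
    obtain ⟨φ, hφ, H, hH, rfl⟩ := hu
    simpa using smul_mem_polyMaps hφ (hL H hH)
  | zero =>
    convert Submodule.zero_mem _ using 1
    funext t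
    simp
  | add u v _ _ hu hv => simpa using! Submodule.add_mem _ hu hv
  | smul c u _ hu => simpa using! Submodule.smul_mem _ c hu

theorem polar_add [CompleteSpace E] {k : ℕ} {H H' : E → E} (hH : H ∈ homPoly E k)
    (hH' : H' ∈ homPoly E k) :
    polar k (H + H') = polar k H + polar k H' := by
  rw [polar, iteratedFDeriv_add_apply (analyticAt_of_mem_homPoly hH 0).contDiffAt
    (analyticAt_of_mem_homPoly hH' 0).contDiffAt, smul_add]
  rfl

theorem polar_smul [CompleteSpace E] {k : ℕ} (c : ℂ) {H : E → E} (hH : H ∈ homPoly E k) :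
    polar k (c • H) = c • polar k H := by
  rw [polar, iteratedFDeriv_const_smul_apply (analyticAt_of_mem_homPoly hH 0).contDiffAt,
    smul_comm]
  rfl

theorem polar_zero [CompleteSpace E] (k : ℕ) : polar k (0 : E → E) = 0 := by
  simpa using polar_smul (0 : ℂ) (Submodule.zero_mem (homPoly E k))

theorem polar_apply_mem_lineDegree [CompleteSpace E] {k N : ℕ} {u : (Fin m → ℂ) → E → E}
    (hu : u ∈ polyMaps E m k N) (ℓ : E →L[ℂ] ℂ) (v : Fin k → E) :
    (fun t => ℓ (polar k (u t) v)) ∈ lineDegree m N := by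
  have hmem := fun u (hu : u ∈ polyMaps E m k N) t => mem_homPoly_of_mem_polyMaps hu t
  induction hu using Submodule.span_induction with
  | mem u hu =>
    obtain ⟨φ, hφ, H, hH, rfl⟩ := hu
    convert Submodule.smul_mem _ (ℓ (polar k H v)) hφ using 1
    funext t
    simp [polar_smul _ hH, mul_comm]
  | zero =>
    convert Submodule.zero_mem _ using 1
    funext t
    simp [polar_zero]
  | add u v hu hv h h' =>
    convert Submodule.add_mem _ h h' using 1
    funext t
    simp [polar_add (hmem u hu t) (hmem v hv t)]
  | smul c u hu h =>
    convert Submodule.smul_mem _ c h using 1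
    funext t
    simp [polar_smul c (hmem u hu t)]

/-- The term of degree `k` of the formal linearization of a family of vector fields of degree `d`
in the parameters is polynomial of degree at most `d k` in the parameters. -/
theorem formalLinearization_mem_polyMaps [CompleteSpace E] {d : ℕ}
    {x : ℕ → (Fin m → ℂ) → E → E} (hx : ∀ j, x j ∈ polyMaps E m j d)
    {L : ℕ → (E → E) →ₗ[ℂ] (E → E)}
    (hL : ∀ k, ∀ G ∈ homPoly E (k + 2), L (k + 2) G ∈ homPoly E (k + 2)) (n : ℕ) :
    (fun t => formalLinearization L (fun j => x j t) n) ∈ polyMaps E m n (d * n) := by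
  induction n using Nat.strong_induction_on with
  | _ n ih =>
    rcases n with _ | _ | k
    · simp only [formalLinearization]
      exact Submodule.zero_mem _
    · simp only [zero_add, formalLinearization]
      exact const_mem_polyMaps _ (clm_mem_homPoly (ContinuousLinearMap.id ℂ E))
    · simp only [formalLinearization]
      refine linearMap_apply_mem_polyMaps (hL k) ?_
      convert Submodule.neg_mem _ (Submodule.sum_mem (t := (Finset.univ : Finset (Fin (k + 1))))
        (f := fun i t z => fderiv ℂ (formalLinearization L (fun j => x j t) (i + 1)) z
          (x (k + 2 - i) t z)) _ fun i _ => ?_) using 1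
      · funext t z
        simp
      · have hi : (i : ℕ) + (k + 2 - i) = k + 2 := by omega
        have h := fderiv_apply_mem_polyMaps (ih (i + 1) (by omega)) (hx (k + 2 - i))
        rw [hi] at h
        refine polyMaps_mono _ ?_ h
        calc d * (i + 1) + d = d * (i + 2) := by ring
          _ ≤ d * (k + 2) := Nat.mul_le_mul_left d (by omega)

end Parameters

/-! ### Linearizability as exponential boundedness -/

section Linearizability

variable {n : ℕ}

/-- A vector field with homogeneous parts `x` and non-resonant linear part is linearizable exactly
when the symmetric multilinear maps of its formal linearization grow at most exponentially. -/
theorem isLinearizable_iff {A : (Fin n → ℂ) →L[ℂ] (Fin n → ℂ)}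
    (hA : ∀ k, NoResonance A (k + 2)) {X : (Fin n → ℂ) → (Fin n → ℂ)}
    {x : ℕ → (Fin n → ℂ) → (Fin n → ℂ)} (hX : HasHomExpansion X x) (hx0 : x 0 = 0)
    (hx1 : x 1 = fun z => A z) {H : ℕ → (Fin n → ℂ) → (Fin n → ℂ)}
    (hH : ∀ k, H k ∈ homPoly (Fin n → ℂ) k) (hs : SolvesFormally A x H) (hH0 : H 0 = 0)
    (hH1 : H 1 = fun z => z) :
    IsLinearizable X ↔ ∃ K : ℕ, ∀ k, ‖polar k (H k)‖ ≤ (K : ℝ) ^ k := by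
  have hXA : fderiv ℂ X 0 = A := by
    ext1 v
    rw [← hX.coeff_one_apply, hx1]
  constructor
  · rintro ⟨h, ⟨M, hM⟩, h0, ⟨B, hB⟩, hconj⟩
    have hG : HasHomExpansion h fun k => diagonal k (M k) := ⟨M, hM, fun _ => rfl⟩
    rw [hXA] at hconj
    have hsG := (solvesFormally_iff_eventually_eq hG hX).2 hconj
    have hG1 : ∀ z, diagonal 1 (M 1) z = B z := fun z => by
      have := hG.coeff_one_apply z
      rwa [← hB] at this
    -- the degree one part of the equation says that the linear part of `h` commutes with `A`
    have hBA : ∀ z, B (A z) = A (B z) := by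
      intro z
      have := hsG 1 z
      have hfd : fderiv ℂ (diagonal 1 (M 1)) z = B := by
        rw [funext hG1]
        exact B.toContinuousLinearMap.fderiv
      simpa [Finset.Nat.antidiagonal_succ, hx0, hx1, hfd, hG1] using this
    have hsBH : SolvesFormally A x fun k z => B (H k z) := by
      intro k z
      have hfd : ∀ i, fderiv ℂ (fun w => B (H i w)) z =
          B.toContinuousLinearMap.comp (fderiv ℂ (H i) z) := fun i =>
        (B.toContinuousLinearMap.hasFDerivAt.comp z
          (differentiableAt_of_mem_homPoly (hH i) z).hasFDerivAt).fderiv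
      simp only [hfd, ContinuousLinearMap.comp_apply, ContinuousLinearEquiv.coe_coe]
      rw [← map_sum, hs k z, hBA]
    have huniq := SolvesFormally.unique hA hx0 hx1 (fun k => diagonal_mem (M k))
      (fun k => comp_mem_homPoly B.toContinuousLinearMap (hH k)) hsG hsBH
      (by
        funext z
        rw [hG.coeff_zero_apply z, h0]
        simp [hH0])
      (by
        funext z
        rw [hG1]
        simp [hH1])
    obtain ⟨C, r, hC, hr, hb⟩ := M.le_mul_pow_of_radius_pos hM.radius_pos
    set c : ℝ := ‖(B.symm : (Fin n → ℂ) →L[ℂ] (Fin n → ℂ))‖ * C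
    obtain ⟨K, hK⟩ := exists_nat_ge ((max c 1) * r)
    refine ⟨K, fun k => ?_⟩
    have hHk : H k = diagonal k
        ((B.symm : (Fin n → ℂ) →L[ℂ] (Fin n → ℂ)).compContinuousMultilinearMap (M k)) := by
      funext z
      have := congrFun (huniq k) z
      change H k z = B.symm (diagonal k (M k) z)
      rw [this]
      simp
    rcases k.eq_zero_or_pos with rfl | hk
    · simp [hH0, polar_zero]
    calc ‖polar k (H k)‖ ≤ ‖(B.symm : (Fin n → ℂ) →L[ℂ] (Fin n → ℂ))‖ * ‖M k‖ := by
          rw [hHk]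
          exact (norm_polar_diagonal_le _).trans
            (ContinuousLinearMap.norm_compContinuousMultilinearMap_le _ _)
      _ ≤ c * r ^ k := by
          rw [mul_assoc]
          gcongr
          exact hb k
      _ ≤ (max c 1) ^ k * r ^ k := by
          gcongr
          exact (le_max_left _ _).trans (le_self_pow₀ (le_max_right _ _) hk.ne')
      _ ≤ (K : ℝ) ^ k := by
          rw [← mul_pow]
          gcongr
  · rintro ⟨K, hK⟩
    set M : FormalMultilinearSeries ℂ (Fin n → ℂ) (Fin n → ℂ) := fun k => polar k (H k)
    have hrad : 0 < M.radius := by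
      have hpos : (0 : NNReal) < (K + 1 : NNReal)⁻¹ := by positivity
      refine lt_of_lt_of_le (ENNReal.coe_pos.2 hpos) (M.le_radius_of_bound 1 fun k => ?_)
      push_cast
      rw [inv_pow, ← div_eq_mul_inv, div_le_one (by positivity)]
      exact (hK k).trans (by gcongr; linarith)
    have hM : HasFPowerSeriesAt M.sum M 0 := (M.hasFPowerSeriesOnBall hrad).hasFPowerSeriesAt
    have hexp : HasHomExpansion M.sum H := ⟨M, hM, fun k => (diagonal_polar (hH k)).symm⟩
    refine ⟨M.sum, hM.analyticAt, ?_, ?_, ?_⟩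
    · rw [← hexp.coeff_zero_apply 0, hH0]
      rfl
    · have : fderiv ℂ M.sum 0 = ContinuousLinearMap.id ℂ (Fin n → ℂ) := by
        ext1 v
        rw [← hexp.coeff_one_apply, hH1]
        rfl
      rw [this]
      exact ⟨ContinuousLinearEquiv.refl ℂ _, rfl⟩
    · rw [hXA]
      exact (solvesFormally_iff_eventually_eq hexp hX).1 hs

/-- Operator norm bounds may be tested on the coordinates of values at tuples from the unit
ball. -/
theorem norm_le_iff_forall_unitBall {k : ℕ} (M : (Fin n → ℂ) [×k]→L[ℂ] (Fin n → ℂ)) {C : ℝ}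
    (hC : 0 ≤ C) : ‖M‖ ≤ C ↔
      ∀ (v : Fin k → Metric.closedBall (0 : Fin n → ℂ) 1) (c : Fin n),
        ‖M (fun i => (v i : Fin n → ℂ)) c‖ ≤ C := by
  constructor
  · intro h v c
    refine (norm_le_pi_norm _ c).trans ((M.le_opNorm _).trans ?_)
    refine (mul_le_of_le_one_right (norm_nonneg _) ?_).trans h
    exact Finset.prod_le_one (fun _ _ => norm_nonneg _)
      fun i _ => mem_closedBall_zero_iff.1 (v i).2
  · intro h
    refine M.opNorm_le_bound hC fun v => ?_
    -- normalize the arguments; `w i = 0` if `v i = 0`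
    set w : Fin k → Fin n → ℂ := fun i => ((‖v i‖ : ℂ)⁻¹) • v i
    have hw : ∀ i, w i ∈ Metric.closedBall (0 : Fin n → ℂ) 1 := by
      intro i
      rw [mem_closedBall_zero_iff, norm_smul, norm_inv, Complex.norm_real, norm_norm]
      exact inv_mul_le_one
    have hv : v = fun i => (‖v i‖ : ℂ) • w i := by
      funext i
      rcases eq_or_ne (v i) 0 with h0 | h0
      · simp [w, h0]
      · rw [smul_smul, mul_inv_cancel₀ (by simpa using h0), one_smul]
    have hMw : ‖M w‖ ≤ C := (pi_norm_le_iff_of_nonneg hC).2 fun c => h (fun i => ⟨w i, hw i⟩) c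
    calc ‖M v‖ = ‖M fun i => (‖v i‖ : ℂ) • w i‖ := by rw [← hv]
      _ = (∏ i, ‖v i‖) * ‖M w‖ := by
        rw [M.map_smul_univ, norm_smul, norm_prod]
        simp
      _ ≤ C * ∏ i, ‖v i‖ := by
        rw [mul_comm]
        gcongr

end Linearizability

/-! ### The polynomial family of vector fields -/

theorem hasEigenvalue_toLin'_iff {n : ℕ} {A : Matrix (Fin n) (Fin n) ℂ} {l : Fin n → ℂ}
    (hl : A.charpoly.roots = Finset.univ.val.map l) (μ : ℂ) :
    Module.End.HasEigenvalue (Matrix.toLin' A) μ ↔ ∃ j, l j = μ := by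
  rw [Module.End.hasEigenvalue_iff_isRoot_charpoly, Matrix.charpoly_toLin',
    ← Polynomial.mem_roots A.charpoly_monic.ne_zero, hl]
  simp

theorem noResonance_of_nonResonant {n : ℕ} {A : Matrix (Fin n) (Fin n) ℂ} {l : Fin n → ℂ}
    (hl : A.charpoly.roots = Finset.univ.val.map l) (hres : NonResonant l) (k : ℕ) :
    NoResonance (Matrix.toLin' A).toContinuousLinearMap (k + 2) := by
  intro μ hμ hsum
  change ∀ i, Module.End.HasEigenvalue (Matrix.toLin' A) (μ i) at hμ
  change Module.End.HasEigenvalue (Matrix.toLin' A) (∑ i, μ i) at hsum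
  simp only [hasEigenvalue_toLin'_iff hl] at hμ hsum
  choose j hj using hμ
  obtain ⟨j₀, hj₀⟩ := hsum
  refine hres (fun a => (Finset.univ.filter fun i => j i = a).card) ?_ j₀ ?_
  · rw [← Finset.card_eq_sum_card_fiberwise fun i _ => Finset.mem_coe.2 (Finset.mem_univ (j i))]
    simp
  · rw [hj₀, sub_eq_zero, ← Finset.sum_fiberwise Finset.univ j μ]
    refine Finset.sum_congr rfl fun a _ => ?_
    rw [Finset.sum_congr rfl (g := fun _ => l a) fun i hi => by
      rw [← hj i, (Finset.mem_filter.1 hi).2]]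
    simp

theorem hasHomExpansion_of_isBigO {n : ℕ} {f : (Fin n → ℂ) → (Fin n → ℂ)} (hf : AnalyticAt ℂ f 0)
    (hf2 : f =O[𝓝 0] fun z => ‖z‖ ^ 2) :
    ∃ F, HasHomExpansion f F ∧ F 0 = 0 ∧ F 1 = 0 := by
  obtain ⟨p, hp⟩ := hf
  have hF : HasHomExpansion f fun k => diagonal k (p k) := ⟨p, hp, fun _ => rfl⟩
  have h2 : f =O[𝓝 0] fun z => ‖z - 0‖ ^ 2 := by simpa using hf2
  refine ⟨_, hF, funext fun z => ?_, funext fun z => ?_⟩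
  · rw [hF.coeff_zero_apply]
    exact h2.eq_zero_of_norm_pow two_ne_zero
  · rw [hF.coeff_one_apply, (h2.hasFDerivAt one_lt_two).fderiv]
    rfl

/-- The parameters for which the vector field of the family is linearizable are those at which
some family of polynomials, with degrees dominated by the weights, is exponentially bounded. -/
theorem exists_isLinearizable_iff_mem_expBounded {n m d : ℕ} {A : Matrix (Fin n) (Fin n) ℂ}
    {l : Fin n → ℂ} (hl : A.charpoly.roots = Finset.univ.val.map l) (hres : NonResonant l)
    {f : (Fin m → ℕ) → (Fin n → ℂ) → (Fin n → ℂ)}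
    (hf : ∀ i, ∑ j, i j ≤ d → AnalyticAt ℂ (f i) 0)
    (hf2 : ∀ i, ∑ j, i j ≤ d → f i =O[𝓝 0] fun z => ‖z‖ ^ 2) :
    ∃ (I : Type) (p : I → (Fin m → ℂ) → ℂ) (ν : I → ℕ), (∀ i, p i ∈ lineDegree m (d * ν i)) ∧
      {t | IsLinearizable (polyFamily d A f t)} = expBounded p ν := by
  set A' : (Fin n → ℂ) →L[ℂ] (Fin n → ℂ) := (Matrix.toLin' A).toContinuousLinearMap
  have hA' : ∀ z, A' z = A.mulVec z := fun z => rfl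
  have hres' := noResonance_of_nonResonant hl hres
  have hF : ∀ i, ∃ F : ℕ → (Fin n → ℂ) → (Fin n → ℂ), i ∈ multiIndices m d →
      HasHomExpansion (f i) F ∧ F 0 = 0 ∧ F 1 = 0 := by
    intro i
    by_cases hi : i ∈ multiIndices m d
    · obtain ⟨F, hF⟩ := hasHomExpansion_of_isBigO (hf i (mem_multiIndices.1 hi))
        (hf2 i (mem_multiIndices.1 hi))
      exact ⟨F, fun _ => hF⟩
    · exact ⟨0, fun h => absurd h hi⟩
  choose F hF using hF
  set x : ℕ → (Fin m → ℂ) → (Fin n → ℂ) → (Fin n → ℂ) := fun k t z =>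
    (if k = 1 then A' z else 0) + ∑ i ∈ multiIndices m d, (∏ j, t j ^ i j) • F i k z with hx
  have hX : ∀ t, HasHomExpansion (polyFamily d A f t) fun k => x k t := fun t =>
    (HasHomExpansion.clm A').add
      (HasHomExpansion.sum _ fun i hi => (hF i hi).1.const_smul (∏ j, t j ^ i j))
  have hx0 : ∀ t, x 0 t = 0 := by
    intro t
    funext z
    simp only [hx, zero_ne_one, if_false, zero_add]
    exact Finset.sum_eq_zero fun i hi => by simp [(hF i hi).2.1]
  have hx1 : ∀ t, x 1 t = fun z => A' z := by
    intro t
    funext z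
    simp only [hx, if_true]
    rw [Finset.sum_eq_zero fun i hi => by simp [(hF i hi).2.2], add_zero]
  have hxmem : ∀ k t, x k t ∈ homPoly (Fin n → ℂ) k := fun k t => (hX t).mem_homPoly k
  have hxpoly : ∀ k, x k ∈ polyMaps (Fin n → ℂ) m k d := by
    intro k
    have : x k = (fun _ z => if k = 1 then A' z else 0) +
        ∑ i ∈ multiIndices m d, fun t => (∏ j, t j ^ i j) • F i k := by
      funext t z
      simp [hx]
    rw [this]
    refine Submodule.add_mem _
      (const_mem_polyMaps d ((HasHomExpansion.clm A').mem_homPoly k)) ?_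
    exact Submodule.sum_mem _ fun i hi => smul_mem_polyMaps
      (prod_pow_mem_lineDegree (mem_multiIndices.1 hi)) ((hF i hi).1.mem_homPoly k)
  choose L hL using fun k => exists_homological_inverse (hres' k)
  set L' : ℕ → ((Fin n → ℂ) → (Fin n → ℂ)) →ₗ[ℂ] ((Fin n → ℂ) → (Fin n → ℂ)) :=
    fun k => L (k - 2)
  have hL' : ∀ k, ∀ G ∈ homPoly (Fin n → ℂ) (k + 2), L' (k + 2) G ∈ homPoly (Fin n → ℂ) (k + 2) ∧
      ∀ z, fderiv ℂ (L' (k + 2) G) z (A' z) - A' (L' (k + 2) G z) = G z := hL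
  set H : ℕ → (Fin m → ℂ) → (Fin n → ℂ) → (Fin n → ℂ) := fun k t =>
    formalLinearization L' (fun j => x j t) k
  have hHpoly : ∀ k, H k ∈ polyMaps (Fin n → ℂ) m k (d * k) :=
    formalLinearization_mem_polyMaps hxpoly fun k G hG => (hL' k G hG).1
  refine ⟨Σ k : ℕ, (Fin k → Metric.closedBall (0 : Fin n → ℂ) 1) × Fin n,
    fun i t => polar i.1 (H i.1 t) (fun s => (i.2.1 s : Fin n → ℂ)) i.2.2, fun i => i.1,
    fun i => polar_apply_mem_lineDegree (hHpoly i.1)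
      (ContinuousLinearMap.proj (R := ℂ) (φ := fun _ : Fin n => ℂ) i.2.2) _, ?_⟩
  ext t
  rw [Set.mem_ofPred_eq, isLinearizable_iff hres' (hX t) (hx0 t) (hx1 t)
    (H := fun k => H k t) (fun k => mem_homPoly_of_mem_polyMaps (hHpoly k) t)
    (formalLinearization_solves (fun k => hxmem k t) (hx0 t) (hx1 t) hL')
    (by simp only [H, formalLinearization]) (by simp only [H, formalLinearization])]
  refine exists_congr fun K => ?_
  simp only [norm_le_iff_forall_unitBall _ (pow_nonneg (Nat.cast_nonneg (α := ℝ) K) _)]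
  exact ⟨fun h i => h i.1 i.2.1 i.2.2, fun h k v c => h ⟨k, v, c⟩⟩

end SmallDivisors

theorem theorem5 (n m d : ℕ) (hm : 1 ≤ m)
    (A : Matrix (Fin n) (Fin n) ℂ)
    (l : Fin n → ℂ) (hl : A.charpoly.roots = Finset.univ.val.map l)
    (hres : SmallDivisors.NonResonant l)
    (f : (Fin m → ℕ) → (Fin n → ℂ) → (Fin n → ℂ))
    (hf : ∀ i, ∑ j, i j ≤ d → AnalyticAt ℂ (f i) 0)
    (hf2 : ∀ i, ∑ j, i j ≤ d → f i =O[𝓝 0] fun z => ‖z‖ ^ 2) :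
    Xor
      (∀ t : Fin m → ℂ, SmallDivisors.IsLinearizable (SmallDivisors.polyFamily d A f t))
      (SmallDivisors.gammaCapacity
        {t : Fin m → ℂ | SmallDivisors.IsLinearizable (SmallDivisors.polyFamily d A f t)} = 0) := by
  obtain ⟨m, rfl⟩ : ∃ k, m = k + 1 := ⟨m - 1, by omega⟩
  obtain ⟨I, p, ν, hp, hE⟩ :=
    SmallDivisors.exists_isLinearizable_iff_mem_expBounded hl hres hf hf2
  by_cases h : SmallDivisors.gammaCapacity
      {t | SmallDivisors.IsLinearizable (SmallDivisors.polyFamily d A f t)} = 0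
  · refine Or.inr ⟨h, fun hall => SmallDivisors.gammaCapacity_univ_ne_zero m ?_⟩
    rwa [← Set.eq_univ_of_forall hall]
  · refine Or.inl ⟨fun t => ?_, h⟩
    have : t ∈ SmallDivisors.expBounded p ν :=
      SmallDivisors.mem_expBounded_of_gammaCapacity_ne_zero hp (hE ▸ h) t
    rwa [← hE] at this
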